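/- Let $\alpha,\beta\in\mathbb R$ with $\beta\neq 0$, let $p(\xi)=-\beta\xi^5+\alpha\xi^3$, and write $\langle y\rangle=1+|y|$. For $s,b\in\mathbb R$ let $X_{s,b}=X_{s,b}(\mathbb R\times\mathbb R)$ be the completion of $C_0^\infty(\mathbb R\times\mathbb R)$ (complex-valued smooth functions $f(x,t)$ with compact support) with respect to the norm $$\|f\|_{X_{s,b}}=\Big(\int_{\mathbb R}\int_{\mathbb R}\langle\xi\rangle^{2s}\,\langle\tau-p(\xi)\rangle^{2b}\,|\widehat f(\xi,\tau)|^2\,d\xi\,d\tau\Big)^{1/2},\qquad \widehat f(\xi,\tau)=\int_{\mathbb R}\int_{\mathbb R} e^{-i(x\xi+t\tau)}f(x,t)\,dx\,dt .$$ **Lemma 5.2 (bilinear estimate).** There is an absolute constant $\varepsilon_0>0$ such that for all real $\alpha$ and $\beta\ne0$, all $s\ge-\frac14$ and all $0<\varepsilon<\varepsilon_0$ there is a constant $C>0$, depending only on $\alpha,\beta,s,\varepsilon$, with the following property. For all $u,v\in C_0^\infty(\mathbb R\times\mathbb R)$, $$\|uv\|_{L^2(\mathbb R\times\mathbb R)}\le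 C\,\|u\|_{X_{-1/2,\,1/2-\varepsilon}}\,\|v\|_{X_{s,\,1/2+\varepsilon}} .$$ Moreover, the pointwise product of functions in $C_0^\infty(\mathbb R\times\mathbb R)$ extends to a bounded bilinear map $(u,v)\mapsto uv$ from $X_{-1/2,\,1/2-\varepsilon}\times X_{s,\,1/2+\varepsilon}$ to $L^2(\mathbb R\times\mathbb R)$, and the same inequality, with the same $C$, holds for all $u\in X_{-1/2,\,1/2-\varepsilon}$ and $v\in X_{s,\,1/2+\varepsilon}$. -/

import Mathlib

open MeasureTheory
open scoped ContDiff SchwartzMap FourierTransform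

noncomputable section

namespace Kawahara

/-- The space `C_0^∞(ℝ × ℝ)` of complex-valued smooth functions with compact support; points of the
physical space `ℝ × ℝ` are written `(x, t)`. -/
abbrev TestFun : Type := TestFunction (⊤ : TopologicalSpace.Opens (ℝ × ℝ)) ℂ (⊤ : ℕ∞)

/-- The bracket `⟨y⟩ = 1 + |y|`. -/
def jb (y : ℝ) : ℝ := 1 + |y|

/-- The phase function `p(ξ) = -β ξ⁵ + α ξ³` of the linear equation
`v_t + α v_xxx + β v_xxxxx = 0`. -/
def phase (α β ξ : ℝ) : ℝ := -β * ξ ^ 5 + α * ξ ^ 3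

/-- The space-time Fourier transform
`f̂(ξ, τ) = ∫∫ exp(-i (x ξ + t τ)) f(x, t) dx dt`, where `ζ = (ξ, τ)`. -/
def spacetimeFourier (f : ℝ × ℝ → ℂ) (ζ : ℝ × ℝ) : ℂ :=
  ∫ z : ℝ × ℝ, Complex.exp (-(Complex.I * ((z.1 * ζ.1 + z.2 * ζ.2 : ℝ) : ℂ))) * f z

/-- The Bourgain norm
`‖f‖_{X_{s,b}} = (∫∫ ⟨ξ⟩^{2s} ⟨τ - p(ξ)⟩^{2b} |f̂(ξ, τ)|² dξ dτ)^{1/2}` of a test function. -/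
def bourgainNorm (α β s b : ℝ) (f : TestFun) : ℝ :=
  Real.sqrt (∫ ζ : ℝ × ℝ, jb ζ.1 ^ (2 * s) * jb (ζ.2 - phase α β ζ.1) ^ (2 * b) *
    ‖spacetimeFourier f ζ‖ ^ 2)

/-! The Bourgain norm of a test function is finite, and it is a seminorm. -/

lemma jb_pos (y : ℝ) : 0 < jb y := by unfold jb; positivity

lemma one_le_jb (y : ℝ) : 1 ≤ jb y := by unfold jb; linarith [abs_nonneg y]

/-- The square root of the weight. -/
def weight (α β s b : ℝ) (ζ : ℝ × ℝ) : ℝ := jb ζ.1 ^ s * jb (ζ.2 - phase α β ζ.1) ^ b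

lemma weight_sq (α β s b : ℝ) (ζ : ℝ × ℝ) :
    weight α β s b ζ ^ 2 = jb ζ.1 ^ (2 * s) * jb (ζ.2 - phase α β ζ.1) ^ (2 * b) := by
  unfold weight
  rw [mul_pow, ← Real.rpow_natCast, ← Real.rpow_natCast, ← Real.rpow_mul (jb_pos _).le,
    ← Real.rpow_mul (jb_pos _).le]
  push_cast
  rw [mul_comm s, mul_comm b]

lemma weight_nonneg (α β s b : ℝ) (ζ : ℝ × ℝ) : 0 ≤ weight α β s b ζ :=
  mul_nonneg (Real.rpow_nonneg (jb_pos _).le _) (Real.rpow_nonneg (jb_pos _).le _)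

lemma continuous_weight (α β s b : ℝ) : Continuous (weight α β s b) := by
  unfold weight phase jb
  refine Continuous.mul ?_ ?_
  · refine Continuous.rpow_const (by fun_prop) fun ζ => Or.inl ?_
    exact (jb_pos ζ.1).ne'
  · refine Continuous.rpow_const (by fun_prop) fun ζ => Or.inl ?_
    exact (jb_pos (ζ.2 - phase α β ζ.1)).ne'

lemma jb_rpow_le {y R : ℝ} (hR : jb y ≤ R) (s : ℝ) : jb y ^ s ≤ R ^ ⌈|s|⌉₊ := by
  have h1 : 1 ≤ R := (one_le_jb y).trans hR
  calc jb y ^ s ≤ jb y ^ ((⌈|s|⌉₊ : ℕ) : ℝ) :=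
        Real.rpow_le_rpow_of_exponent_le (one_le_jb y) ((le_abs_self s).trans (Nat.le_ceil _))
    _ = jb y ^ ⌈|s|⌉₊ := Real.rpow_natCast _ _
    _ ≤ R ^ ⌈|s|⌉₊ := pow_le_pow_left₀ (jb_pos y).le hR _

lemma weight_le (α β s b : ℝ) : ∃ C : ℝ, ∃ k : ℕ, ∀ ζ : ℝ × ℝ,
    weight α β s b ζ ≤ C * (1 + ‖ζ‖) ^ k := by
  refine ⟨(1 + |β| + |α|) ^ ⌈|b|⌉₊, ⌈|s|⌉₊ + 5 * ⌈|b|⌉₊, fun ζ => ?_⟩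
  have hx : |ζ.1| ≤ ‖ζ‖ := norm_fst_le ζ
  have ht : |ζ.2| ≤ ‖ζ‖ := norm_snd_le ζ
  have hn := norm_nonneg ζ
  have h1 : jb ζ.1 ≤ 1 + ‖ζ‖ := by unfold jb; linarith
  have h2 : jb (ζ.2 - phase α β ζ.1) ≤ (1 + |β| + |α|) * (1 + ‖ζ‖) ^ 5 := by
    have e5 : |ζ.1| ^ 5 ≤ (1 + ‖ζ‖) ^ 5 := pow_le_pow_left₀ (abs_nonneg _) (by linarith) _
    have e3 : |ζ.1| ^ 3 ≤ (1 + ‖ζ‖) ^ 5 :=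
      (pow_le_pow_left₀ (abs_nonneg _) (by linarith) 3).trans
        (pow_le_pow_right₀ (by linarith) (by norm_num))
    have e1 : 1 + ‖ζ‖ ≤ (1 + ‖ζ‖) ^ 5 := le_self_pow₀ (by linarith) (by norm_num)
    have e : |ζ.2 - phase α β ζ.1| ≤ |ζ.2| + (|β| * |ζ.1| ^ 5 + |α| * |ζ.1| ^ 3) := by
      refine (abs_sub _ _).trans ?_
      gcongr
      unfold phase
      refine (abs_add_le _ _).trans ?_
      simp [abs_mul, abs_pow]
    have m5 := mul_le_mul_of_nonneg_left e5 (abs_nonneg β)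
    have m3 := mul_le_mul_of_nonneg_left e3 (abs_nonneg α)
    unfold jb
    nlinarith
  calc weight α β s b ζ
      ≤ (1 + ‖ζ‖) ^ ⌈|s|⌉₊ * ((1 + |β| + |α|) * (1 + ‖ζ‖) ^ 5) ^ ⌈|b|⌉₊ := by
        unfold weight
        exact mul_le_mul (jb_rpow_le h1 s) (jb_rpow_le h2 b)
          (Real.rpow_nonneg (jb_pos _).le _) (by positivity)
    _ = _ := by rw [mul_pow, ← pow_mul, pow_add]; ring

/-- The Fourier transform of a test function is a Schwartz function. -/
lemma exists_schwartz (f : TestFun) :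
    ∃ F : 𝓢(ℝ × ℝ, ℂ), ∀ ζ, F ζ = spacetimeFourier f ζ := by
  let e : WithLp 2 (ℝ × ℝ) ≃L[ℝ] ℝ × ℝ := WithLp.prodContinuousLinearEquiv 2 ℝ ℝ ℝ
  let G : 𝓢(WithLp 2 (ℝ × ℝ), ℂ) := SchwartzMap.compCLMOfContinuousLinearEquiv ℂ e
    (f.hasCompactSupport.toSchwartzMap f.contDiff)
  let a : (ℝ × ℝ) ≃L[ℝ] WithLp 2 (ℝ × ℝ) :=
    (ContinuousLinearEquiv.smulLeft (Units.mk0 (2 * Real.pi)⁻¹ (by positivity))).trans e.symm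
  refine ⟨SchwartzMap.compCLMOfContinuousLinearEquiv ℂ a (𝓕 G), fun ζ => ?_⟩
  rw [SchwartzMap.compCLMOfContinuousLinearEquiv_apply, Function.comp_apply,
    SchwartzMap.fourier_coe, Real.fourier_eq', spacetimeFourier,
    ← (WithLp.volume_preserving_ofLp ℝ ℝ).integral_comp
      (MeasurableEquiv.toLp 2 (ℝ × ℝ)).symm.measurableEmbedding]
  refine integral_congr_ae (Filter.Eventually.of_forall fun v => ?_)
  have hinner : -2 * Real.pi * inner ℝ v (a ζ) = -(v.fst * ζ.1 + v.snd * ζ.2) := by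
    have : inner ℝ v (a ζ) = (2 * Real.pi)⁻¹ * (v.fst * ζ.1 + v.snd * ζ.2) := by
      have h1 : (a ζ).fst = (2 * Real.pi)⁻¹ * ζ.1 := rfl
      have h2 : (a ζ).snd = (2 * Real.pi)⁻¹ * ζ.2 := rfl
      have hi : ∀ y w : ℝ, inner ℝ y w = w * y := fun y w => by simp
      simp only [WithLp.prod_inner_apply, WithLp.ofLp_fst, WithLp.ofLp_snd, h1, h2, hi]
      ring
    rw [this]
    field_simp
  simp only [hinner, smul_eq_mul]
  congr 1
  congr 1
  change _ = -(Complex.I * ((v.fst * ζ.1 + v.snd * ζ.2 : ℝ) : ℂ))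
  push_cast
  ring

lemma memLp_weight_mul (α β s b : ℝ) (f : TestFun) :
    MemLp (fun ζ => (weight α β s b ζ : ℂ) * spacetimeFourier f ζ) 2
      (volume : Measure (ℝ × ℝ)) := by
  obtain ⟨F, hF⟩ := exists_schwartz f
  obtain ⟨C, k, hC⟩ := weight_le α β s b
  simp only [← hF]
  have hmeas : AEStronglyMeasurable (fun ζ => (weight α β s b ζ : ℂ) * F ζ)
      (volume : Measure (ℝ × ℝ)) :=
    ((Complex.continuous_ofReal.comp (continuous_weight α β s b)).mul
      F.continuous).aestronglyMeasurable
  rw [memLp_two_iff_integrable_sq_norm hmeas]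
  set S := 2 ^ (k + 2) *
    (Finset.Iic (k + 2, 0)).sup (fun m => SchwartzMap.seminorm ℝ m.1 m.2) F with hS
  have hdec : ∀ ζ, (1 + ‖ζ‖) ^ (k + 2) * ‖F ζ‖ ≤ S := fun ζ => by
    simpa using SchwartzMap.one_add_le_sup_seminorm_apply (𝕜 := ℝ) (m := (k + 2, 0))
      (k := k + 2) (n := 0) le_rfl le_rfl F ζ
  have hint : Integrable (fun ζ : ℝ × ℝ => (C * S) ^ 2 * (1 + ‖ζ‖) ^ (-(4 : ℝ))) volume := by
    refine (integrable_one_add_norm ?_).const_mul _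
    simp
    norm_num
  refine hint.mono' (hmeas.norm.pow 2) (Filter.Eventually.of_forall fun ζ => ?_)
  have hpos : 0 < 1 + ‖ζ‖ := by positivity
  rw [norm_mul, Complex.norm_real, Real.norm_of_nonneg (weight_nonneg _ _ _ _ _),
    Real.norm_of_nonneg (by positivity)]
  have hw := weight_nonneg α β s b ζ
  have h1 : weight α β s b ζ * ‖F ζ‖ * (1 + ‖ζ‖) ^ 2 ≤ C * S := by
    have hC0 : 0 ≤ C := by
      have := hw.trans (hC ζ)
      exact nonneg_of_mul_nonneg_left this (by positivity)
    calc weight α β s b ζ * ‖F ζ‖ * (1 + ‖ζ‖) ^ 2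
        ≤ (C * (1 + ‖ζ‖) ^ k) * ‖F ζ‖ * (1 + ‖ζ‖) ^ 2 := by gcongr; exact hC ζ
      _ = C * ((1 + ‖ζ‖) ^ (k + 2) * ‖F ζ‖) := by ring
      _ ≤ C * S := by gcongr; exact hdec ζ
  rw [Real.rpow_neg hpos.le, ← div_eq_mul_inv, le_div_iff₀ (by positivity)]
  have : (1 + ‖ζ‖) ^ (4 : ℝ) = ((1 + ‖ζ‖) ^ 2) ^ 2 := by
    rw [← pow_mul]; exact_mod_cast Real.rpow_natCast (1 + ‖ζ‖) 4
  rw [this, ← mul_pow]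
  exact pow_le_pow_left₀ (by positivity) h1 2

lemma integrable_fourier_kernel (f : TestFun) (ζ : ℝ × ℝ) :
    Integrable (fun z : ℝ × ℝ =>
      Complex.exp (-(Complex.I * ((z.1 * ζ.1 + z.2 * ζ.2 : ℝ) : ℂ))) * f z) volume := by
  refine Continuous.integrable_of_hasCompactSupport ?_ f.hasCompactSupport.mul_left
  have := f.continuous
  fun_prop

lemma spacetimeFourier_add (f g : TestFun) (ζ : ℝ × ℝ) :
    spacetimeFourier ⇑(f + g) ζ = spacetimeFourier f ζ + spacetimeFourier g ζ := by
  unfold spacetimeFourier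
  rw [← integral_add (integrable_fourier_kernel f ζ) (integrable_fourier_kernel g ζ)]
  congr 1
  ext z
  simp [mul_add]

lemma spacetimeFourier_smul (c : ℂ) (f : TestFun) (ζ : ℝ × ℝ) :
    spacetimeFourier ⇑(c • f) ζ = c * spacetimeFourier f ζ := by
  unfold spacetimeFourier
  rw [← integral_const_mul]
  congr 1
  ext z
  simp
  ring

/-- The weighted Fourier transform of a test function, as an element of `L²`. -/
def weightedLp (α β s b : ℝ) (f : TestFun) : Lp ℂ 2 (volume : Measure (ℝ × ℝ)) :=
  (memLp_weight_mul α β s b f).toLp _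

lemma bourgainNorm_eq (α β s b : ℝ) (f : TestFun) :
    bourgainNorm α β s b f = ‖weightedLp α β s b f‖ := by
  have h := L2.inner_def (𝕜 := ℂ) (weightedLp α β s b f) (weightedLp α β s b f)
  have h2 : ‖weightedLp α β s b f‖ ^ 2 = ∫ ζ : ℝ × ℝ, jb ζ.1 ^ (2 * s) *
      jb (ζ.2 - phase α β ζ.1) ^ (2 * b) * ‖spacetimeFourier f ζ‖ ^ 2 := by
    rw [inner_self_eq_norm_sq_to_K] at h
    have h3 : ∫ ζ, inner ℂ (weightedLp α β s b f ζ) (weightedLp α β s b f ζ) =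
        ((∫ ζ : ℝ × ℝ, jb ζ.1 ^ (2 * s) * jb (ζ.2 - phase α β ζ.1) ^ (2 * b) *
          ‖spacetimeFourier f ζ‖ ^ 2 : ℝ) : ℂ) := by
      rw [← integral_complex_ofReal]
      refine integral_congr_ae ?_
      filter_upwards [(memLp_weight_mul α β s b f).coeFn_toLp] with ζ hζ
      rw [weightedLp, hζ, inner_self_eq_norm_sq_to_K, ← weight_sq, norm_mul, Complex.norm_real,
        Real.norm_of_nonneg (weight_nonneg _ _ _ _ _)]
      push_cast
      simp
      ring
    rw [h3] at h
    exact Complex.ofReal_injective (by simpa using h)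
  rw [bourgainNorm, ← h2, Real.sqrt_sq (norm_nonneg _)]

lemma bourgainNorm_add_le (α β s b : ℝ) (f g : TestFun) :
    bourgainNorm α β s b (f + g) ≤ bourgainNorm α β s b f + bourgainNorm α β s b g := by
  simp only [bourgainNorm_eq]
  have : weightedLp α β s b (f + g) = weightedLp α β s b f + weightedLp α β s b g := by
    unfold weightedLp
    rw [← MemLp.toLp_add]
    congr 1
    ext ζ
    rw [Pi.add_apply, spacetimeFourier_add, mul_add]
  rw [this]
  exact norm_add_le _ _

lemma bourgainNorm_smul (α β s b : ℝ) (c : ℂ) (f : TestFun) :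
    bourgainNorm α β s b (c • f) = ‖c‖ * bourgainNorm α β s b f := by
  simp only [bourgainNorm_eq]
  have : weightedLp α β s b (c • f) = c • weightedLp α β s b f := by
    unfold weightedLp
    rw [← MemLp.toLp_const_smul]
    congr 1
    ext ζ
    rw [Pi.smul_apply, spacetimeFourier_smul, smul_eq_mul]
    ring
  rw [this, norm_smul]

/-- The vector space `C_0^∞(ℝ × ℝ)`, to be endowed with the norm of `X_{s,b}` (and not with its
usual topology). -/
def PreX (_α _β _s _b : ℝ) : Type := TestFun

instance (α β s b : ℝ) : AddCommGroup (PreX α β s b) := inferInstanceAs (AddCommGroup TestFun)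

instance (α β s b : ℝ) : Module ℂ (PreX α β s b) := inferInstanceAs (Module ℂ TestFun)

instance (α β s b : ℝ) : Norm (PreX α β s b) := ⟨fun f => bourgainNorm α β s b f⟩

lemma preX_core (α β s b : ℝ) : SeminormedSpace.Core ℂ (PreX α β s b) where
  norm_nonneg _ := Real.sqrt_nonneg _
  norm_smul c f := bourgainNorm_smul α β s b c f
  norm_triangle f g := bourgainNorm_add_le α β s b f g

instance (α β s b : ℝ) : SeminormedAddCommGroup (PreX α β s b) :=
  SeminormedAddCommGroup.ofCore (preX_core α β s b)

instance (α β s b : ℝ) : NormedSpace ℂ (PreX α β s b) where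
  norm_smul_le c f := (bourgainNorm_smul α β s b c f).le

/-- The Bourgain space `X_{s,b}`: the completion of `C_0^∞(ℝ × ℝ)` with respect to the norm
`bourgainNorm α β s b`. -/
abbrev X (α β s b : ℝ) : Type := UniformSpace.Completion (PreX α β s b)

/-- A test function, regarded as an element of the normed space `PreX α β s b`. -/
def toPre (α β s b : ℝ) : TestFun ≃ₗ[ℂ] PreX α β s b := LinearEquiv.refl ℂ TestFun

lemma norm_toPre (α β s b : ℝ) (f : TestFun) : ‖toPre α β s b f‖ = bourgainNorm α β s b f := rfl

/-- The canonical embedding of `C_0^∞(ℝ × ℝ)` into `X_{s,b}`. -/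
def toX (α β s b : ℝ) (f : TestFun) : X α β s b := (toPre α β s b f : X α β s b)

lemma norm_toX (α β s b : ℝ) (f : TestFun) : ‖toX α β s b f‖ = bourgainNorm α β s b f :=
  UniformSpace.Completion.norm_coe _

end Kawahara

end

/-! By Plancherel and the convolution theorem, the estimate is an L² bound for a convolution of the
weighted transforms with a multiplier. Let `x`, `y` be the frequencies of `u`, `v`, let `ξ = x + y`,
and let `σ₁`, `σ₂` be the brackets of the modulations. As `s ≥ -1/4`, the squared multiplier is at
most `⟨x⟩ ⟨y⟩^(1/2) σ₁^(-1+2ε) σ₂^(-(1+2ε))`. The power of `σ₂` is integrable, that of `σ₁` narrowly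
fails to be, and a growth of order 3/2 in frequency has to be absorbed.

Dispersion supplies the gain. At fixed `ξ` the derivative of `p(x) + p(ξ - x)` has size at least
`|β| N³ Q` for high frequencies, where `N = max |x| |y|` and `Q = min |x + y| |x - y|`
(`le_phaseGap`). If `σ₁ ≤ (N^(3/2) Q)²`, then `σ₁^(4ε)` is at most `N^(3/2) Q`; the squared
multiplier is then bounded by the derivative times integrable powers of both modulations, and the
substitution `x ↦ p(x) + p(ξ - x)` integrates it (`lintegral_highGap_le`). If `σ₁` is larger, its
own decay gives `N^(3/2) (1 + N^(3/2) Q)^(-3/2)`, an approximate delta in `Q` whose integral does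
not depend on the scale.

When `Q = |x - y|` this delta is integrated in `x` at fixed `ξ`; when `Q = |x + y|` it must be
integrated in `ξ` at fixed `x`. Hence the Schur test `lintegral_bilinear_sq_le` with two kernels,
one for each order of integration, fed by the pointwise bound `multiplier_le`. Density then carries
the bound to the completions. -/

namespace Kawahara

open scoped ENNReal

/-! ### Schur test for bilinear convolutions -/

lemma sq_lintegral_mul_le {Ω : Type*} [MeasurableSpace Ω] {μ : Measure Ω} {a b : Ω → ℝ≥0∞}
    (ha : AEMeasurable a μ) (hb : AEMeasurable b μ) :
    (∫⁻ x, a x * b x ∂μ) ^ 2 ≤ (∫⁻ x, a x ^ 2 ∂μ) * ∫⁻ x, b x ^ 2 ∂μ := by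
  have h := ENNReal.lintegral_mul_le_Lp_mul_Lq μ Real.HolderConjugate.two_two ha hb
  have hs : ∀ y : ℝ≥0∞, (y ^ (1 / 2 : ℝ)) ^ 2 = y := fun y => by
    rw [← ENNReal.rpow_natCast, ← ENNReal.rpow_mul]; norm_num
  calc _ ≤ _ := pow_le_pow_left' h 2
    _ = _ := by simp only [mul_pow, hs, ENNReal.rpow_two]

lemma add_sq_le_two_mul (a b : ℝ≥0∞) : (a + b) ^ 2 ≤ 2 * (a ^ 2 + b ^ 2) := by
  have := ENNReal.rpow_add_le_mul_rpow_add_rpow a b (p := 2) (by norm_num)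
  norm_num at this
  exact this

/-- A Schur test for bilinear convolution operators: each of the two summands bounding the square
of the multiplier is integrated in a different variable. -/
lemma lintegral_bilinear_sq_le {m k₁ k₂ : ℝ × ℝ → ℝ × ℝ → ℝ≥0∞} {f g : ℝ × ℝ → ℝ≥0∞}
    (hk₁ : Measurable (Function.uncurry k₁)) (hk₂ : Measurable (Function.uncurry k₂))
    (hf : Measurable f) (hg : Measurable g) (hm : ∀ ζ z, m ζ z ^ 2 ≤ k₁ ζ z + k₂ ζ z)
    {C₁ C₂ : ℝ≥0∞} (h₁ : ∀ ζ, ∫⁻ z, k₁ ζ z ≤ C₁) (h₂ : ∀ z, ∫⁻ ζ, k₂ ζ z ≤ C₂) :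
    ∫⁻ ζ, (∫⁻ z, m ζ z * (f z * g (ζ - z))) ^ 2 ≤
      2 * (C₁ + C₂) * ((∫⁻ z, f z ^ 2) * ∫⁻ z, g z ^ 2) := by
  have hs : ∀ y : ℝ≥0∞, (y ^ (1 / 2 : ℝ)) ^ 2 = y := fun y => by
    rw [← ENNReal.rpow_natCast, ← ENNReal.rpow_mul]; norm_num
  have hs' : ∀ y : ℝ≥0∞, (y ^ 2) ^ (1 / 2 : ℝ) = y := fun y => by
    rw [← ENNReal.rpow_natCast, ← ENNReal.rpow_mul]; norm_num
  have hmle : ∀ ζ z, m ζ z ≤ k₁ ζ z ^ (1 / 2 : ℝ) + k₂ ζ z ^ (1 / 2 : ℝ) := fun ζ z => by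
    rw [← hs' (m ζ z)]
    exact (ENNReal.rpow_le_rpow (hm ζ z) (by norm_num)).trans
      (ENNReal.rpow_add_le_add_rpow _ _ (by norm_num) (by norm_num))
  have hg' : ∀ ζ, Measurable fun z => g (ζ - z) := fun ζ => hg.comp (measurable_const.sub measurable_id)
  have hgu : Measurable fun q : (ℝ × ℝ) × (ℝ × ℝ) => g (q.1 - q.2) :=
    hg.comp (measurable_fst.sub measurable_snd)
  have hfu : Measurable fun q : (ℝ × ℝ) × (ℝ × ℝ) => f q.2 := hf.comp measurable_snd
  have hk₁s : ∀ ζ, Measurable (k₁ ζ) := fun ζ => hk₁.comp measurable_prodMk_left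
  have hk₂s : ∀ ζ, Measurable (k₂ ζ) := fun ζ => hk₂.comp measurable_prodMk_left
  have htrans : ∀ z, ∫⁻ ζ, g (ζ - z) ^ 2 = ∫⁻ ζ, g ζ ^ 2 := fun z =>
    lintegral_sub_right_eq_self (fun ζ => g ζ ^ 2) z
  have htrans' : ∀ ζ, ∫⁻ z, g (ζ - z) ^ 2 = ∫⁻ z, g z ^ 2 := fun ζ =>
    lintegral_sub_left_eq_self (fun z => g z ^ 2) ζ
  -- Cauchy–Schwarz separates `k₁` from `f g`; Tonelli and translation invariance then split the
  -- integral of `f² g²`.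
  have hA : ∫⁻ ζ, (∫⁻ z, k₁ ζ z ^ (1 / 2 : ℝ) * (f z * g (ζ - z))) ^ 2 ≤
      C₁ * ((∫⁻ z, f z ^ 2) * ∫⁻ z, g z ^ 2) := by
    calc _ ≤ ∫⁻ ζ, C₁ * ∫⁻ z, f z ^ 2 * g (ζ - z) ^ 2 := by
          refine lintegral_mono fun ζ => ?_
          refine (sq_lintegral_mul_le ((hk₁s ζ).pow_const _).aemeasurable
            (hf.mul (hg' ζ)).aemeasurable).trans ?_
          simp only [Pi.mul_apply, hs, mul_pow]
          gcongr
          exact h₁ ζ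
      _ = C₁ * ∫⁻ z, ∫⁻ ζ, f z ^ 2 * g (ζ - z) ^ 2 := by
          rw [lintegral_const_mul _ (by
            exact ((hfu.pow_const 2).mul (hgu.pow_const 2)).lintegral_prod_right'),
            lintegral_lintegral_swap ((hfu.pow_const 2).mul (hgu.pow_const 2)).aemeasurable]
      _ = _ := by
          congr 1
          rw [← lintegral_mul_const _ (hf.pow_const 2)]
          refine lintegral_congr fun z => ?_
          have hgz : Measurable fun ζ => g (ζ - z) ^ 2 :=
            (hg.comp (measurable_id.sub measurable_const)).pow_const 2
          rw [lintegral_const_mul _ hgz, htrans]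
  -- Here `k₂` stays with `f`: the other factor is the norm of a translate of `g`, free of `ζ`, so
  -- Tonelli leaves `k₂` to be integrated in `ζ`.
  have hB : ∫⁻ ζ, (∫⁻ z, k₂ ζ z ^ (1 / 2 : ℝ) * (f z * g (ζ - z))) ^ 2 ≤
      C₂ * ((∫⁻ z, f z ^ 2) * ∫⁻ z, g z ^ 2) := by
    calc _ ≤ ∫⁻ ζ, (∫⁻ z, k₂ ζ z * f z ^ 2) * ∫⁻ z, g z ^ 2 := by
          refine lintegral_mono fun ζ => ?_
          simp only [← mul_assoc]
          refine (sq_lintegral_mul_le (((hk₂s ζ).pow_const _).mul hf).aemeasurable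
            (hg' ζ).aemeasurable).trans ?_
          simp only [Pi.mul_apply, hs, mul_pow, htrans']
          exact le_rfl
      _ = (∫⁻ z, ∫⁻ ζ, k₂ ζ z * f z ^ 2) * ∫⁻ z, g z ^ 2 := by
          rw [lintegral_mul_const _ (by exact (hk₂.mul (hfu.pow_const 2)).lintegral_prod_right'),
            lintegral_lintegral_swap (hk₂.mul (hfu.pow_const 2)).aemeasurable]
      _ ≤ (∫⁻ z, C₂ * f z ^ 2) * ∫⁻ z, g z ^ 2 := by
          gcongr with z
          have hkz : Measurable fun ζ => k₂ ζ z := hk₂.comp measurable_prodMk_right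
          rw [lintegral_mul_const _ hkz]
          gcongr
          exact h₂ z
      _ = _ := by rw [lintegral_const_mul _ (hf.pow_const 2), mul_assoc]
  have hmeas₁ : Measurable fun ζ => ∫⁻ z, k₁ ζ z ^ (1 / 2 : ℝ) * (f z * g (ζ - z)) :=
    ((hk₁.pow_const _).mul (hfu.mul hgu)).lintegral_prod_right'
  calc _ ≤ ∫⁻ ζ, 2 * ((∫⁻ z, k₁ ζ z ^ (1 / 2 : ℝ) * (f z * g (ζ - z))) ^ 2 +
        (∫⁻ z, k₂ ζ z ^ (1 / 2 : ℝ) * (f z * g (ζ - z))) ^ 2) := by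
        refine lintegral_mono fun ζ => ?_
        refine le_trans (pow_le_pow_left' ?_ 2) (add_sq_le_two_mul _ _)
        have hkζ : Measurable fun z => k₁ ζ z ^ (1 / 2 : ℝ) * (f z * g (ζ - z)) :=
          ((hk₁s ζ).pow_const _).mul (hf.mul (hg' ζ))
        rw [← lintegral_add_left hkζ]
        refine lintegral_mono fun z => ?_
        rw [← add_mul]
        gcongr
        exact hmle ζ z
    _ = 2 * ((∫⁻ ζ, (∫⁻ z, k₁ ζ z ^ (1 / 2 : ℝ) * (f z * g (ζ - z))) ^ 2) +
        ∫⁻ ζ, (∫⁻ z, k₂ ζ z ^ (1 / 2 : ℝ) * (f z * g (ζ - z))) ^ 2) := by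
        rw [lintegral_const_mul' _ _ (by norm_num), lintegral_add_left (hmeas₁.pow_const 2)]
    _ ≤ 2 * (C₁ * ((∫⁻ z, f z ^ 2) * ∫⁻ z, g z ^ 2) +
        C₂ * ((∫⁻ z, f z ^ 2) * ∫⁻ z, g z ^ 2)) := by gcongr
    _ = _ := by ring

/-! ### Changes of variables and integrable weights -/

/-- One-sided change of variables for nonnegative functions of one real variable. -/
lemma setLIntegral_deriv_mul_comp_le {φ φ' : ℝ → ℝ} {S : Set ℝ} (hS : MeasurableSet S)
    (hφ : ∀ x, HasDerivAt φ (φ' x) x) (hinj : Set.InjOn φ S) (g : ℝ → ℝ≥0∞) :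
    ∫⁻ x in S, ENNReal.ofReal |φ' x| * g (φ x) ≤ ∫⁻ y, g y := by
  rw [← lintegral_image_eq_lintegral_abs_deriv_mul hS
    (fun x _ => (hφ x).hasDerivWithinAt) hinj g]
  exact setLIntegral_le_lintegral _ _

/-- The integrable weight `⟨y⟩^{-r}`, valued in `[0, ∞]`. -/
noncomputable def decay (r y : ℝ) : ℝ≥0∞ := ENNReal.ofReal (jb y ^ (-r))

lemma measurable_decay (r : ℝ) : Measurable (decay r) := by
  unfold decay jb
  fun_prop

lemma lintegral_decay_lt_top {r : ℝ} (hr : 1 < r) : ∫⁻ y, decay r y < ⊤ := by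
  have : Integrable (fun y : ℝ => (1 + ‖y‖) ^ (-r)) volume :=
    integrable_one_add_norm (by simpa using hr)
  simpa [decay, jb] using this.lintegral_lt_top

/-- Integrating out the modulation variable. -/
lemma lintegral_mul_comp_modulation {F J : ℝ → ℝ≥0∞} (hF : Measurable F) (hJ : Measurable J)
    {σ : ℝ × ℝ → ℝ} (hσ : Measurable σ) (h : ∀ x, ∫⁻ t, J (σ (x, t)) = ∫⁻ t, J t) :
    ∫⁻ z : ℝ × ℝ, F z.1 * J (σ z) = (∫⁻ x, F x) * ∫⁻ t, J t := by
  rw [Measure.volume_eq_prod, lintegral_prod _ (by fun_prop), ← lintegral_mul_const _ hF]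
  refine lintegral_congr fun x => ?_
  have hJx : Measurable fun t => J (σ (x, t)) := by fun_prop
  exact (lintegral_const_mul (F x) hJx).trans (by rw [h])

/-- Substituting `y = l (a x + b)` produces the factor `l |a| ≥ l`, so the bound is uniform in the
scale `l`. -/
lemma lintegral_scaled_decay_le {r : ℝ} {l : ℝ} (hl : 0 < l) {a : ℝ} (ha : 1 ≤ |a|) (b : ℝ) :
    ∫⁻ x, ENNReal.ofReal (l * (1 + l * |a * x + b|) ^ (-r)) ≤ ∫⁻ y, decay r y := by
  have ha0 : a ≠ 0 := by rintro rfl; norm_num at ha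
  have h := setLIntegral_deriv_mul_comp_le (φ := fun x => l * (a * x + b)) (φ' := fun _ => l * a)
    MeasurableSet.univ (fun x => by
      simpa using (((hasDerivAt_id x).const_mul a).add_const b).const_mul l)
    (fun x _ y _ hxy => by
      have := mul_left_cancel₀ hl.ne' hxy
      exact mul_left_cancel₀ ha0 (add_right_cancel this)) (decay r)
  rw [setLIntegral_univ] at h
  refine le_trans (lintegral_mono fun x => ?_) h
  have e : jb (l * (a * x + b)) = 1 + l * |a * x + b| := by
    rw [jb, abs_mul, abs_of_pos hl]
  rw [decay, e, ← ENNReal.ofReal_mul (abs_nonneg _), abs_mul, abs_of_pos hl]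
  refine ENNReal.ofReal_le_ofReal ?_
  have : 0 ≤ (1 + l * |a * x + b|) ^ (-r) := by positivity
  nlinarith [mul_nonneg (mul_nonneg hl.le this) (sub_nonneg.2 ha)]

/-! ### Dispersion: the substitution by the sum of the phases -/

/-- The derivative of `x ↦ p(x) + p(ξ - x)` in terms of `x` and `y = ξ - x`. -/
def phaseGap (α β x y : ℝ) : ℝ :=
  (x ^ 2 - y ^ 2) * (3 * α - 5 * β * (x ^ 2 + y ^ 2))

lemma hasDerivAt_phase_add_phase (α β ξ x : ℝ) :
    HasDerivAt (fun x => phase α β x + phase α β (ξ - x)) (phaseGap α β x (ξ - x)) x := by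
  have h1 : HasDerivAt (fun x => ξ - x) (-1) x := by simpa using (hasDerivAt_id x).const_sub ξ
  have h := (((hasDerivAt_pow 5 x).const_mul (-β)).add ((hasDerivAt_pow 3 x).const_mul α)).add
    (((h1.pow 5).const_mul (-β)).add ((h1.pow 3).const_mul α))
  refine (h.congr_deriv ?_).congr_of_eventuallyEq ?_
  · unfold phaseGap; push_cast; ring
  · exact Filter.Eventually.of_forall fun y => by simp [phase]

/-- At fixed `ξ` the sum of the phases is a quadratic polynomial in `(2x - ξ)²`. The second factor
of its difference quotient vanishes only for small frequencies, so on each side of `ξ / 2` the map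
is injective at high frequency. -/
lemma injOn_phase_add_phase {α β R ξ : ℝ} (hβ : β ≠ 0) (hR : 3 * |α| ≤ 4 * |β| * R)
    (hξ : ξ ≠ 0) {S : Set ℝ} (hS : ∀ x ∈ S, R < x ^ 2 + (ξ - x) ^ 2)
    (hsign : ∀ x ∈ S, ∀ y ∈ S, 0 ≤ (2 * x - ξ) * (2 * y - ξ)) :
    Set.InjOn (fun x => phase α β x + phase α β (ξ - x)) S := by
  intro x hx y hy hxy
  have hx' := hS x hx
  have hy' := hS y hy
  have key : ((2 * x - ξ) ^ 2 - (2 * y - ξ) ^ 2) * (ξ * (3 * α / 4 - 5 * β / 8 *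
      ((x ^ 2 + (ξ - x) ^ 2) + (y ^ 2 + (ξ - y) ^ 2)))) = 0 := by
    have : phase α β x + phase α β (ξ - x) - (phase α β y + phase α β (ξ - y)) = 0 := by
      simpa [sub_eq_zero] using hxy
    rw [← this]; unfold phase; ring
  have hne : ξ * (3 * α / 4 - 5 * β / 8 *
      ((x ^ 2 + (ξ - x) ^ 2) + (y ^ 2 + (ξ - y) ^ 2))) ≠ 0 := by
    refine mul_ne_zero hξ fun h => ?_
    have h2 : 3 * |α| / 4 = 5 * |β| / 8 * ((x ^ 2 + (ξ - x) ^ 2) + (y ^ 2 + (ξ - y) ^ 2)) := by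
      have h3 := congrArg abs (sub_eq_zero.1 h)
      rw [abs_mul, abs_div, abs_div, abs_mul, abs_mul,
        abs_of_nonneg (a := (x ^ 2 + (ξ - x) ^ 2) + (y ^ 2 + (ξ - y) ^ 2)) (by positivity)] at h3
      simpa using h3
    have hb := abs_pos.2 hβ
    have := mul_lt_mul_of_pos_left (add_lt_add hx' hy') hb
    nlinarith [abs_nonneg α]
  have hsq : (2 * x - ξ) ^ 2 = (2 * y - ξ) ^ 2 := by
    rcases mul_eq_zero.1 key with h | h
    · linarith
    · exact absurd h hne
  rcases sq_eq_sq_iff_eq_or_eq_neg.1 hsq with h | h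
  · linarith
  · have := hsign x hx y hy
    rw [h] at this
    have : (2 * y - ξ) ^ 2 = 0 := by nlinarith [sq_nonneg (2 * y - ξ)]
    have := pow_eq_zero_iff (two_ne_zero) |>.1 this
    linarith

/-- The factor 2 counts the two sides of `ξ / 2`, on each of which the substitution is injective. -/
lemma lintegral_phaseGap_le {α β R ξ : ℝ} (hβ : β ≠ 0) (hR : 3 * |α| ≤ 4 * |β| * R)
    (hξ : ξ ≠ 0) (g : ℝ → ℝ≥0∞) :
    ∫⁻ x in {x | R < x ^ 2 + (ξ - x) ^ 2}, ENNReal.ofReal |phaseGap α β x (ξ - x)| *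
      g (phase α β x + phase α β (ξ - x)) ≤ 2 * ∫⁻ y, g y := by
  have hm : MeasurableSet {x : ℝ | R < x ^ 2 + (ξ - x) ^ 2} :=
    measurableSet_lt (by fun_prop) (by fun_prop)
  have hpos : MeasurableSet {x : ℝ | 0 ≤ 2 * x - ξ} :=
    measurableSet_le (by fun_prop) (by fun_prop)
  have hneg : MeasurableSet {x : ℝ | 2 * x - ξ ≤ 0} :=
    measurableSet_le (by fun_prop) (by fun_prop)
  have hsub : {x : ℝ | R < x ^ 2 + (ξ - x) ^ 2} ⊆
      ({x | R < x ^ 2 + (ξ - x) ^ 2} ∩ {x | 0 ≤ 2 * x - ξ}) ∪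
      ({x | R < x ^ 2 + (ξ - x) ^ 2} ∩ {x | 2 * x - ξ ≤ 0}) := fun x hx =>
    (le_total 0 (2 * x - ξ)).imp (fun h => ⟨hx, h⟩) (fun h => ⟨hx, h⟩)
  refine (lintegral_mono_set hsub).trans ((lintegral_union_le _ _ _).trans ?_)
  rw [two_mul]
  refine add_le_add ?_ ?_
  · exact setLIntegral_deriv_mul_comp_le (hm.inter hpos) (hasDerivAt_phase_add_phase α β ξ)
      (injOn_phase_add_phase hβ hR hξ (fun x hx => hx.1)
        fun x hx y hy => mul_nonneg hx.2 hy.2) g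
  · exact setLIntegral_deriv_mul_comp_le (hm.inter hneg) (hasDerivAt_phase_add_phase α β ξ)
      (injOn_phase_add_phase hβ hR hξ (fun x hx => hx.1)
        fun x hx y hy => mul_nonneg_of_nonpos_of_nonpos hx.2 hy.2) g

/-- The indicator of the high-frequency region, times `|p'(x) - p'(y)|`. -/
noncomputable def highGap (α β R x y : ℝ) : ℝ≥0∞ :=
  if R < x ^ 2 + y ^ 2 ∧ x + y ≠ 0 then ENNReal.ofReal |phaseGap α β x y| else 0

lemma measurable_highGap (α β R : ℝ) :
    Measurable fun q : ℝ × ℝ => highGap α β R q.1 q.2 := by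
  unfold highGap phaseGap
  have h1 : MeasurableSet {q : ℝ × ℝ | R < q.1 ^ 2 + q.2 ^ 2} :=
    measurableSet_lt (by fun_prop) (by fun_prop)
  have h2 : MeasurableSet {q : ℝ × ℝ | q.1 + q.2 = 0} :=
    measurableSet_eq_fun (by fun_prop) (by fun_prop)
  exact Measurable.ite (h1.inter h2.compl) (by fun_prop) measurable_const

/-- At a fixed first modulation `t`, the second one varies with `x` only through the sum of the
phases, whose derivative is the gap. The `x` integral is thus a substitution, and `J t` remains. -/
lemma lintegral_highGap_le {α β R : ℝ} (hβ : β ≠ 0) (hR : 3 * |α| ≤ 4 * |β| * R)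
    {J : ℝ → ℝ≥0∞} (hJ : Measurable J) (ζ : ℝ × ℝ) :
    ∫⁻ z : ℝ × ℝ, highGap α β R z.1 (ζ - z).1 *
      (J (z.2 - phase α β z.1) * J ((ζ - z).2 - phase α β (ζ - z).1)) ≤
      2 * (∫⁻ y, J y) ^ 2 := by
  obtain ⟨ξ, τ⟩ := ζ
  have hp : Measurable (phase α β) := by unfold phase; fun_prop
  have hG : Measurable fun x => highGap α β R x (ξ - x) :=
    (measurable_highGap α β R).comp (measurable_id.prodMk (measurable_const.sub measurable_id))
  have hm : MeasurableSet {x : ℝ | R < x ^ 2 + (ξ - x) ^ 2} :=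
    measurableSet_lt (by fun_prop) (by fun_prop)
  calc _ = ∫⁻ x, ∫⁻ t, highGap α β R x (ξ - x) *
        (J (t - phase α β x) * J (τ - t - phase α β (ξ - x))) := by
        have hF : Measurable fun z : ℝ × ℝ => highGap α β R z.1 (ξ - z.1) *
            (J (z.2 - phase α β z.1) * J (τ - z.2 - phase α β (ξ - z.1))) :=
          (hG.comp measurable_fst).mul (by fun_prop)
        simp only [Prod.fst_sub, Prod.snd_sub]
        rw [Measure.volume_eq_prod, lintegral_prod _ hF.aemeasurable]
    _ = ∫⁻ x, ∫⁻ t, highGap α β R x (ξ - x) *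
        (J t * J (τ - t - (phase α β x + phase α β (ξ - x)))) := by
        refine lintegral_congr fun x => ?_
        -- Shifting `t` by the first phase makes it the first modulation, so that `J t` no longer
        -- depends on `x`.
        rw [← lintegral_sub_right_eq_self (μ := volume) (fun t => highGap α β R x (ξ - x) *
          (J t * J (τ - t - (phase α β x + phase α β (ξ - x))))) (phase α β x)]
        refine lintegral_congr fun t => ?_
        have : τ - (t - phase α β x) - (phase α β x + phase α β (ξ - x)) =
          τ - t - phase α β (ξ - x) := by ring
        rw [this]
    _ = ∫⁻ t, ∫⁻ x, highGap α β R x (ξ - x) *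
        (J t * J (τ - t - (phase α β x + phase α β (ξ - x)))) := by
        have hF : Measurable fun q : ℝ × ℝ => highGap α β R q.1 (ξ - q.1) *
            (J q.2 * J (τ - q.2 - (phase α β q.1 + phase α β (ξ - q.1)))) :=
          (hG.comp measurable_fst).mul (by fun_prop)
        exact lintegral_lintegral_swap hF.aemeasurable
    _ ≤ ∫⁻ t, J t * (2 * ∫⁻ y, J y) := by
        refine lintegral_mono fun t => ?_
        have : ∫⁻ x, highGap α β R x (ξ - x) *
            J (τ - t - (phase α β x + phase α β (ξ - x))) ≤ 2 * ∫⁻ y, J y := by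
          -- For `ξ = 0` the sum of the phases is constant and cannot be substituted; `highGap` is
          -- zero there.
          by_cases hξ : ξ = 0
          · simp [highGap, hξ]
          have h := lintegral_phaseGap_le hβ hR hξ (fun y => J (τ - t - y))
          rw [lintegral_sub_left_eq_self J] at h
          refine le_trans (le_of_eq ?_) h
          rw [← lintegral_indicator hm]
          refine lintegral_congr fun x => ?_
          simp only [highGap, Set.indicator, Set.mem_ofPred_eq, add_sub_cancel, hξ, ne_eq,
            not_false_eq_true, and_true]
          split_ifs <;> simp
        calc _ = ∫⁻ x, J t * (highGap α β R x (ξ - x) *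
              J (τ - t - (phase α β x + phase α β (ξ - x)))) :=
              lintegral_congr fun x => by ring
          _ = J t * ∫⁻ x, (highGap α β R x (ξ - x) *
              J (τ - t - (phase α β x + phase α β (ξ - x)))) :=
              lintegral_const_mul _ (by fun_prop)
          _ ≤ _ := by gcongr
    _ = _ := by rw [lintegral_mul_const _ hJ]; ring

/-! ### Pointwise bound of the multiplier -/

/-- Kernels at comparable scales are comparable: one factor `A` comes from the height, `A ^ r` from
the bracket. -/
lemma mul_scaled_rpow_le {a b A Q r : ℝ} (ha : 0 < a) (hA : 1 ≤ A) (hab : a ≤ A * b)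
    (hba : b ≤ A * a) (hQ : 0 ≤ Q) (hr : 0 ≤ r) :
    a * (1 + a * Q) ^ (-r) ≤ A ^ (1 + r) * (b * (1 + b * Q) ^ (-r)) := by
  have hA0 : 0 < A := by linarith
  have hb : 0 < b := by
    by_contra h
    nlinarith
  have h1 : (1 + b * Q) / A ≤ 1 + a * Q := by
    rw [div_le_iff₀ hA0]
    nlinarith [mul_le_mul_of_nonneg_right hba hQ]
  have h2 : (1 + a * Q) ^ (-r) ≤ A ^ r * (1 + b * Q) ^ (-r) := by
    calc (1 + a * Q) ^ (-r) ≤ ((1 + b * Q) / A) ^ (-r) :=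
          Real.rpow_le_rpow_of_nonpos (by positivity) h1 (by linarith)
      _ = _ := by
          rw [Real.div_rpow (by positivity) hA0.le, Real.rpow_neg hA0.le, div_inv_eq_mul, mul_comm]
  calc a * (1 + a * Q) ^ (-r) ≤ (A * b) * (A ^ r * (1 + b * Q) ^ (-r)) := by gcongr
    _ = _ := by rw [Real.rpow_add hA0, Real.rpow_one]; ring

/-- The kernel `λ (1 + λ |y|)^{-3/2}` at the scale `λ = ⟨x⟩^{3/2}`. -/
noncomputable def bump (x y : ℝ) : ℝ :=
  jb x ^ (3 / 2 : ℝ) * (1 + jb x ^ (3 / 2 : ℝ) * |y|) ^ (-(3 / 2) : ℝ)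

lemma bump_nonneg (x y : ℝ) : 0 ≤ bump x y := by
  have := jb_pos x
  unfold bump; positivity

lemma scaled_le_bump {N x y : ℝ} (hN : 1 ≤ N) (h1 : N ≤ 2 * |x|) (h2 : |x| ≤ 2 * N) :
    N ^ (3 / 2 : ℝ) * (1 + N ^ (3 / 2 : ℝ) * |y|) ^ (-(3 / 2) : ℝ) ≤
      (3 ^ (3 / 2 : ℝ)) ^ (1 + 3 / 2 : ℝ) * bump x y := by
  have hN0 : 0 < N := by linarith
  have e1 : N ≤ 3 * jb x := by unfold jb; linarith
  have e2 : jb x ≤ 3 * N := by unfold jb; linarith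
  refine mul_scaled_rpow_le (by positivity) (Real.one_le_rpow (by norm_num) (by norm_num)) ?_ ?_
    (abs_nonneg _) (by norm_num)
  · rw [← Real.mul_rpow (by norm_num) (jb_pos _).le]
    exact Real.rpow_le_rpow hN0.le e1 (by norm_num)
  · rw [← Real.mul_rpow (by norm_num) hN0.le]
    exact Real.rpow_le_rpow (jb_pos _).le e2 (by norm_num)

lemma jb_mul_jb_rpow_le {x y M : ℝ} (hx : |x| ≤ M) (hy : |y| ≤ M) :
    jb x * jb y ^ (1 / 2 : ℝ) ≤ (1 + M) ^ (3 / 2 : ℝ) := by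
  have hM : 0 ≤ M := (abs_nonneg x).trans hx
  calc jb x * jb y ^ (1 / 2 : ℝ) ≤ (1 + M) ^ (1 : ℝ) * (1 + M) ^ (1 / 2 : ℝ) := by
        rw [Real.rpow_one]
        have := (jb_pos y).le
        unfold jb at *
        gcongr
    _ = _ := by rw [← Real.rpow_add (by linarith)]; norm_num

lemma max_abs_le_max_abs_add_sub (x y : ℝ) : max |x| |y| ≤ max |x + y| |x - y| := by
  have ex : 2 * |x| ≤ |x + y| + |x - y| := by
    have := abs_add_le (x + y) (x - y)
    rwa [show x + y + (x - y) = 2 * x by ring, abs_mul, abs_two] at this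
  have ey : 2 * |y| ≤ |x + y| + |x - y| := by
    have := abs_sub (x + y) (x - y)
    rwa [show x + y - (x - y) = 2 * y by ring, abs_mul, abs_two] at this
  have a1 := le_max_left |x + y| |x - y|
  have a2 := le_max_right |x + y| |x - y|
  exact max_le (by linarith) (by linarith)

/-- The larger factor of `x² - y² = (x + y)(x - y)` is at least `N`. Beyond `R` the `β` term
dominates the second factor of the gap: `5|β|ρ - 3|α| ≥ |β|ρ` for `ρ = x² + y²`. -/
lemma le_phaseGap {α β R x y N : ℝ} (hR : 3 * |α| ≤ 4 * |β| * R)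
    (hxy : R < x ^ 2 + y ^ 2) (hN : N = max |x| |y|) :
    |β| * N ^ 3 * min |x + y| |x - y| ≤ |phaseGap α β x y| := by
  have hN0 : 0 ≤ N := hN ▸ (abs_nonneg x).trans (le_max_left _ _)
  have hN2 : N ^ 2 ≤ x ^ 2 + y ^ 2 := by
    rcases max_choice |x| |y| with h | h <;> rw [hN, h, sq_abs] <;> nlinarith [sq_nonneg x, sq_nonneg y]
  have hmax : N ≤ max |x + y| |x - y| := hN ▸ max_abs_le_max_abs_add_sub x y
  have h3 : |β| * (x ^ 2 + y ^ 2) ≤ |3 * α - 5 * β * (x ^ 2 + y ^ 2)| := by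
    have := abs_sub_abs_le_abs_sub (5 * β * (x ^ 2 + y ^ 2)) (3 * α)
    rw [abs_sub_comm, abs_mul, abs_mul, abs_mul,
      abs_of_nonneg (a := x ^ 2 + y ^ 2) (by positivity)] at this
    norm_num at this
    nlinarith [mul_le_mul_of_nonneg_left hxy.le (abs_nonneg β)]
  have hprod : N * min |x + y| |x - y| ≤ |x ^ 2 - y ^ 2| := by
    rw [sq_sub_sq, abs_mul, ← max_mul_min |x + y| |x - y|]
    gcongr
  rw [phaseGap, abs_mul]
  calc |β| * N ^ 3 * min |x + y| |x - y| = (N * min |x + y| |x - y|) * (|β| * N ^ 2) := by ring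
    _ ≤ _ := by
      refine mul_le_mul hprod (le_trans ?_ h3) (by positivity) (abs_nonneg _)
      gcongr

/-- If the minimum is `|x - y|`, then `|x + y|` is comparable to `N`. If it is `|x + y|`, either
`|x|` is comparable to `N`, or `N = |y|` and `|x + y| ≥ N / 2`, which leaves pure decay in `y`. -/
lemma scaled_min_le {x y N : ℝ} (hN : N = max |x| |y|) (hN1 : 1 ≤ N) :
    N ^ (3 / 2 : ℝ) * (1 + N ^ (3 / 2 : ℝ) * min |x + y| |x - y|) ^ (-(3 / 2) : ℝ) ≤
      ((3 ^ (3 / 2 : ℝ)) ^ (1 + 3 / 2 : ℝ) + 16) *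
        (bump (x + y) (x - y) + bump x (x + y) + jb y ^ (-2 : ℝ)) := by
  have t3 := bump_nonneg (x + y) (x - y)
  have t4 := bump_nonneg x (x + y)
  have t5 : 0 ≤ jb y ^ (-2 : ℝ) := Real.rpow_nonneg (jb_pos y).le _
  have hN0 : 0 < N := by linarith
  have hxN : |x| ≤ N := hN ▸ le_max_left _ _
  have hyN : |y| ≤ N := hN ▸ le_max_right _ _
  have hNle : N ≤ max |x + y| |x - y| := hN ▸ max_abs_le_max_abs_add_sub x y
  have p : (0 : ℝ) ≤ (3 ^ (3 / 2 : ℝ)) ^ (1 + 3 / 2 : ℝ) := by positivity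
  rcases le_total |x - y| |x + y| with hPM | hPM
  · rw [max_eq_left hPM] at hNle
    rw [min_eq_right hPM]
    have h2 : |x + y| ≤ 2 * N := (abs_add_le x y).trans (by linarith)
    refine (scaled_le_bump hN1 (by linarith) h2).trans ?_
    exact mul_le_mul (by linarith) (by linarith) t3 (by linarith)
  rw [min_eq_left hPM]
  by_cases hx2 : N ≤ 2 * |x|
  · refine (scaled_le_bump hN1 hx2 (by linarith)).trans ?_
    exact mul_le_mul (by linarith) (by linarith) t4 (by linarith)
  have hx2' : 2 * |x| < N := not_le.1 hx2
  have hNy : N = |y| := by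
    rcases max_choice |x| |y| with h | h
    · rw [← hN] at h; linarith [abs_nonneg x]
    · exact hN.trans h
  have hQN : N / 2 ≤ |x + y| := by
    have := abs_sub_abs_le_abs_sub y (-x)
    rw [sub_neg_eq_add, abs_neg, add_comm y x] at this
    linarith
  have hjy : jb y ≤ 2 * N := by rw [jb, ← hNy]; linarith
  have hn0 : 0 < N ^ (3 / 2 : ℝ) := by positivity
  have hbase : N ^ (5 / 2 : ℝ) / 2 ≤ 1 + N ^ (3 / 2 : ℝ) * |x + y| := by
    have : N ^ (5 / 2 : ℝ) = N ^ (3 / 2 : ℝ) * N := by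
      rw [← Real.rpow_add_one hN0.ne']; norm_num
    rw [this]; nlinarith
  calc N ^ (3 / 2 : ℝ) * (1 + N ^ (3 / 2 : ℝ) * |x + y|) ^ (-(3 / 2) : ℝ)
      ≤ N ^ (3 / 2 : ℝ) * (N ^ (5 / 2 : ℝ) / 2) ^ (-(3 / 2) : ℝ) := by
        gcongr N ^ (3 / 2 : ℝ) * ?_
        exact Real.rpow_le_rpow_of_nonpos (by positivity) hbase (by norm_num)
    _ = 2 ^ (3 / 2 : ℝ) * N ^ (-(9 / 4) : ℝ) := by
        rw [Real.div_rpow (by positivity) (by norm_num), Real.rpow_neg (by norm_num : (0:ℝ) ≤ 2),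
          div_inv_eq_mul, ← Real.rpow_mul hN0.le, ← mul_assoc, ← Real.rpow_add hN0, mul_comm]
        norm_num
    -- The exponent `3/2 - 15/4 = -9/4` is relaxed to `-2`, which is still integrable.
    _ ≤ 2 ^ (2 : ℝ) * N ^ (-2 : ℝ) := by
        refine mul_le_mul ?_ ?_ (by positivity) (by positivity)
        · exact Real.rpow_le_rpow_of_exponent_le (by norm_num) (by norm_num)
        · exact Real.rpow_le_rpow_of_exponent_le hN1 (by norm_num)
    _ = 16 * (2 * N) ^ (-2 : ℝ) := by
        rw [Real.mul_rpow (by norm_num) hN0.le]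
        norm_num
        ring
    _ ≤ 16 * jb y ^ (-2 : ℝ) := by
        gcongr 16 * ?_
        exact Real.rpow_le_rpow_of_nonpos (jb_pos y) hjy (by norm_num)
    _ ≤ _ := mul_le_mul (by linarith) (by linarith) t5 (by linarith)

/-- Small modulation: the missing decay `s ^ (4ε)` costs at most `K ^ (8ε) ≤ K`; this uses `ε <
1/8`. -/
lemma rpow_le_of_le_sq {ε s K : ℝ} (hε : 0 < ε) (hε8 : ε < 1 / 8) (hs : 1 ≤ s) (hK0 : 0 ≤ K)
    (hK : s ≤ K ^ 2) : s ^ (-1 + 2 * ε) ≤ K * s ^ (-(1 + 2 * ε)) := by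
  have hs0 : 0 < s := by linarith
  have hK1 : 1 ≤ K := by
    by_contra h
    nlinarith [not_le.1 h]
  rw [show -1 + 2 * ε = 4 * ε + -(1 + 2 * ε) by ring, Real.rpow_add hs0]
  gcongr
  calc s ^ (4 * ε) ≤ (K ^ 2) ^ (4 * ε) := Real.rpow_le_rpow hs0.le hK (by linarith)
    _ = K ^ (8 * ε) := by
        rw [← Real.rpow_natCast, ← Real.rpow_mul (by positivity)]; congr 1; push_cast; ring
    _ ≤ K ^ (1 : ℝ) := Real.rpow_le_rpow_of_exponent_le hK1 (by linarith)
    _ = K := Real.rpow_one _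

/-- Large modulation: `ε < 1/8` leaves the decay `s ^ (-3/4)`, hence the integrable power `-3/2` of
`1 + K`. -/
lemma rpow_le_of_sq_le {ε s K : ℝ} (hε8 : ε < 1 / 8) (hs : 1 ≤ s) (hK0 : 0 ≤ K)
    (hK : K ^ 2 ≤ s) : s ^ (-1 + 2 * ε) ≤ 4 ^ (3 / 4 : ℝ) * (1 + K) ^ (-(3 / 2) : ℝ) := by
  have h4 : (1 + K) ^ 2 / 4 ≤ s := by nlinarith [sq_nonneg (1 - K)]
  calc s ^ (-1 + 2 * ε) ≤ s ^ (-(3 / 4) : ℝ) :=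
        Real.rpow_le_rpow_of_exponent_le hs (by linarith)
    _ ≤ ((1 + K) ^ 2 / 4) ^ (-(3 / 4) : ℝ) :=
        Real.rpow_le_rpow_of_nonpos (by positivity) h4 (by norm_num)
    _ = _ := by
        rw [Real.div_rpow (by positivity) (by norm_num), Real.rpow_neg (by norm_num : (0:ℝ) ≤ 4),
          div_inv_eq_mul, mul_comm, ← Real.rpow_natCast, ← Real.rpow_mul (by positivity)]
        norm_num

/-- The pointwise bound of the multiplier, by the kernels that are integrated in the input
frequency (the first three) and in the output frequency (the last two). -/
lemma multiplier_le {α β : ℝ} (hβ : β ≠ 0) {R : ℝ} (hR : 3 * |α| ≤ 4 * |β| * R) (hR2 : 2 ≤ R) :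
    ∃ C : ℝ, 0 ≤ C ∧ ∀ ε : ℝ, 0 < ε → ε < 1 / 8 → ∀ x y s : ℝ, 1 ≤ s →
      jb x * jb y ^ (1 / 2 : ℝ) * s ^ (-1 + 2 * ε) ≤
        C * ((if x ^ 2 + y ^ 2 ≤ R then 1 else 0) +
          (if R < x ^ 2 + y ^ 2 ∧ x + y ≠ 0 then |phaseGap α β x y| else 0) * s ^ (-(1 + 2 * ε)) +
          bump (x + y) (x - y) + bump x (x + y) + jb y ^ (-2 : ℝ)) := by
  set C₀ : ℝ := (1 + R) ^ (3 / 2 : ℝ) with hC₀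
  set C₁ : ℝ := 2 ^ (3 / 2 : ℝ) * |β|⁻¹ with hC₁
  set C₂ : ℝ := 2 ^ (3 / 2 : ℝ) * 4 ^ (3 / 4 : ℝ) *
    ((3 ^ (3 / 2 : ℝ)) ^ (1 + 3 / 2 : ℝ) + 16) with hC₂
  have p0 : 0 ≤ C₀ := by positivity
  have p1 : 0 ≤ C₁ := by positivity
  have p2 : 0 ≤ C₂ := by positivity
  refine ⟨C₀ + C₁ + C₂, by positivity, fun ε hε hε8 x y s hs => ?_⟩
  have hs0 : 0 < s := by linarith
  have hs1 : s ^ (-1 + 2 * ε) ≤ 1 := Real.rpow_le_one_of_one_le_of_nonpos hs (by linarith)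
  have hsn : 0 ≤ s ^ (-(1 + 2 * ε)) := by positivity
  have t3 := bump_nonneg (x + y) (x - y)
  have t4 := bump_nonneg x (x + y)
  have t5 : 0 ≤ jb y ^ (-2 : ℝ) := Real.rpow_nonneg (jb_pos y).le _
  by_cases hlow : x ^ 2 + y ^ 2 ≤ R
  · have hx : |x| ≤ R := abs_le_of_sq_le_sq (by nlinarith [sq_nonneg y]) (by linarith)
    have hy : |y| ≤ R := abs_le_of_sq_le_sq (by nlinarith [sq_nonneg x]) (by linarith)
    have h1 : jb x * jb y ^ (1 / 2 : ℝ) * s ^ (-1 + 2 * ε) ≤ C₀ * 1 :=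
      mul_le_mul (jb_mul_jb_rpow_le hx hy) hs1 (by positivity) p0
    rw [if_pos hlow, if_neg (fun h => absurd h.1 (not_lt.2 hlow))]
    refine h1.trans (mul_le_mul (by linarith) (by linarith) zero_le_one (by positivity))
  have hhigh : R < x ^ 2 + y ^ 2 := not_le.1 hlow
  set N := max |x| |y| with hN
  set Q := min |x + y| |x - y| with hQ
  have hQ0 : 0 ≤ Q := le_min (abs_nonneg _) (abs_nonneg _)
  have hxN : |x| ≤ N := le_max_left _ _
  have hyN : |y| ≤ N := le_max_right _ _
  -- This is where `2 ≤ R` is needed: `|x|, |y| < 1` would give `x² + y² < 2`.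
  have hN1 : 1 ≤ N := by
    by_contra h
    have hx : |x| < 1 := by linarith
    have hy : |y| < 1 := by linarith
    nlinarith [sq_abs x, sq_abs y, abs_nonneg x, abs_nonneg y]
  have hN0 : 0 < N := by linarith
  have hW : jb x * jb y ^ (1 / 2 : ℝ) ≤ 2 ^ (3 / 2 : ℝ) * N ^ (3 / 2 : ℝ) := by
    rw [← Real.mul_rpow (by norm_num) hN0.le]
    exact (jb_mul_jb_rpow_le hxN hyN).trans
      (Real.rpow_le_rpow (by linarith) (by linarith) (by norm_num))
  have hNN : N ^ (3 / 2 : ℝ) * N ^ (3 / 2 : ℝ) = N ^ 3 := by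
    rw [← Real.rpow_add hN0, ← Real.rpow_natCast]; norm_num
  set n := N ^ (3 / 2 : ℝ) with hn
  have hn0 : 0 < n := by positivity
  rw [if_neg hlow, zero_add]
  -- With `K = n Q`, small modulation leaves `n · n Q = N³ Q`, exactly the size of the gap; large
  -- modulation leaves the scaled kernel in `Q`.
  by_cases hA : s ≤ (n * Q) ^ 2
  · have hxy : x + y ≠ 0 := by
      intro h
      have : Q = 0 := le_antisymm (by rw [hQ, h, abs_zero]; exact min_le_left _ _) hQ0
      rw [this] at hA
      linarith
    rw [if_pos ⟨hhigh, hxy⟩]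
    have hpow := rpow_le_of_le_sq hε hε8 hs (mul_nonneg hn0.le hQ0) hA
    have hgap := le_phaseGap hR hhigh hN
    have hb : 0 < |β| := abs_pos.2 hβ
    calc jb x * jb y ^ (1 / 2 : ℝ) * s ^ (-1 + 2 * ε)
        ≤ (2 ^ (3 / 2 : ℝ) * n) * ((n * Q) * s ^ (-(1 + 2 * ε))) := by
          gcongr
      _ = C₁ * ((|β| * N ^ 3 * Q) * s ^ (-(1 + 2 * ε))) := by
          rw [hC₁, ← hNN]; field_simp
      _ ≤ C₁ * (|phaseGap α β x y| * s ^ (-(1 + 2 * ε))) := by gcongr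
      _ ≤ _ := by
          have : 0 ≤ |phaseGap α β x y| * s ^ (-(1 + 2 * ε)) := by positivity
          refine mul_le_mul (by linarith) (by linarith) this (by positivity)
  have hB : (n * Q) ^ 2 < s := not_le.1 hA
  have hD : 0 ≤ (if R < x ^ 2 + y ^ 2 ∧ x + y ≠ 0 then |phaseGap α β x y| else 0) *
      s ^ (-(1 + 2 * ε)) := mul_nonneg (by split_ifs <;> positivity) hsn
  set D := (if R < x ^ 2 + y ^ 2 ∧ x + y ≠ 0 then |phaseGap α β x y| else 0) *
      s ^ (-(1 + 2 * ε))
  have hpow := rpow_le_of_sq_le hε8 hs (mul_nonneg hn0.le hQ0) hB.le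
  have hmain : jb x * jb y ^ (1 / 2 : ℝ) * s ^ (-1 + 2 * ε) ≤
      2 ^ (3 / 2 : ℝ) * 4 ^ (3 / 4 : ℝ) * (n * (1 + n * Q) ^ (-(3 / 2) : ℝ)) := by
    calc _ ≤ (2 ^ (3 / 2 : ℝ) * n) * (4 ^ (3 / 4 : ℝ) * (1 + n * Q) ^ (-(3 / 2) : ℝ)) := by
          gcongr
      _ = _ := by ring
  have hb := scaled_min_le hN hN1
  rw [← hQ, ← hn] at hb
  set S := bump (x + y) (x - y) + bump x (x + y) + jb y ^ (-2 : ℝ) with hS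
  have hS0 : 0 ≤ S := by positivity
  calc _ ≤ _ := hmain
    _ ≤ 2 ^ (3 / 2 : ℝ) * 4 ^ (3 / 4 : ℝ) * (((3 ^ (3 / 2 : ℝ)) ^ (1 + 3 / 2 : ℝ) + 16) * S) := by
        gcongr
    _ = C₂ * S := by rw [hC₂]; ring
    _ ≤ _ := mul_le_mul (by linarith) (by linarith) hS0 (by positivity)

/-! ### Plancherel and the convolution theorem -/

lemma measurable_spacetimeFourier (f : TestFun) : Measurable (spacetimeFourier f) := by
  obtain ⟨F, hF⟩ := exists_schwartz f
  rw [show spacetimeFourier f = F from funext fun ζ => (hF ζ).symm]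
  exact F.continuous.measurable

/-- A test function as a Schwartz function on the Euclidean plane. -/
noncomputable def toEuclidean (f : TestFun) : 𝓢(WithLp 2 (ℝ × ℝ), ℂ) :=
  SchwartzMap.compCLMOfContinuousLinearEquiv ℂ (WithLp.prodContinuousLinearEquiv 2 ℝ ℝ ℝ)
    (f.hasCompactSupport.toSchwartzMap f.contDiff)

lemma toEuclidean_apply (f : TestFun) (v : WithLp 2 (ℝ × ℝ)) : toEuclidean f v = f v.ofLp := rfl

lemma fourierInv_toEuclidean (f : TestFun) (v : WithLp 2 (ℝ × ℝ)) :
    𝓕⁻ (toEuclidean f) v = spacetimeFourier f ((-(2 * Real.pi)) • v.ofLp) := by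
  rw [SchwartzMap.fourierInv_coe, Real.fourierInv_eq', spacetimeFourier,
    ← (WithLp.volume_preserving_ofLp ℝ ℝ).integral_comp
      (MeasurableEquiv.toLp 2 (ℝ × ℝ)).symm.measurableEmbedding]
  refine integral_congr_ae (Filter.Eventually.of_forall fun w => ?_)
  have hi : ∀ y w : ℝ, inner ℝ y w = w * y := fun y w => by simp
  have h : 2 * Real.pi * inner ℝ w v = -((w.ofLp).1 * ((-(2 * Real.pi)) • v.ofLp).1 +
      (w.ofLp).2 * ((-(2 * Real.pi)) • v.ofLp).2) := by
    simp only [WithLp.prod_inner_apply, hi, Prod.smul_fst, Prod.smul_snd, smul_eq_mul,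
      WithLp.ofLp_fst, WithLp.ofLp_snd]
    ring
  simp only [h, smul_eq_mul, toEuclidean_apply]
  congr 2
  push_cast
  ring

lemma lintegral_enorm_sq_fourier {V : Type*} [NormedAddCommGroup V] [InnerProductSpace ℝ V]
    [FiniteDimensional ℝ V] [MeasurableSpace V] [BorelSpace V] (f : 𝓢(V, ℂ)) :
    ∫⁻ v, ‖𝓕 f v‖ₑ ^ 2 = ∫⁻ v, ‖f v‖ₑ ^ 2 := by
  have key : ∀ g : 𝓢(V, ℂ), ∫⁻ v, ‖g v‖ₑ ^ 2 = ENNReal.ofReal (∫ v, ‖g v‖ ^ 2) := fun g => by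
    have hint : Integrable (fun v => ‖g v‖ ^ 2) volume :=
      (memLp_two_iff_integrable_sq_norm g.continuous.aestronglyMeasurable).1 (g.memLp 2)
    rw [ofReal_integral_eq_lintegral_ofReal hint
      (Filter.Eventually.of_forall fun v => by positivity)]
    refine lintegral_congr fun v => ?_
    rw [← ofReal_norm, ENNReal.ofReal_pow (norm_nonneg _)]
  rw [key, key, SchwartzMap.integral_norm_sq_fourier]

lemma lintegral_comp_smul_ofLp {r : ℝ} (hr : r ≠ 0) {f : ℝ × ℝ → ℝ≥0∞} (hf : Measurable f) :
    ∫⁻ v : WithLp 2 (ℝ × ℝ), f (r • v.ofLp) = ENNReal.ofReal |(r ^ 2)⁻¹| * ∫⁻ z, f z := by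
  have hsm : Measurable fun z : ℝ × ℝ => r • z := measurable_const_smul r
  have h := Measure.map_addHaar_smul (volume : Measure (ℝ × ℝ)) hr
  rw [show Module.finrank ℝ (ℝ × ℝ) = 2 by simp] at h
  calc _ = ∫⁻ z, f (r • z) :=
        (WithLp.volume_preserving_ofLp ℝ ℝ).lintegral_comp (hf.comp hsm)
    _ = ∫⁻ z, f z ∂(Measure.map (fun z : ℝ × ℝ => r • z) volume) := (lintegral_map hf hsm).symm
    _ = _ := by rw [h, lintegral_smul_measure, smul_eq_mul]

/-- Plancherel's theorem and the convolution theorem, as an inequality for the product of two test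
functions. -/
lemma lintegral_enorm_mul_sq_le : ∃ c : ℝ≥0∞, c ≠ ⊤ ∧ ∀ φ ψ : TestFun,
    ∫⁻ z : ℝ × ℝ, ‖φ z * ψ z‖ₑ ^ 2 ≤
      c * ∫⁻ ζ, (∫⁻ z, ‖spacetimeFourier φ z‖ₑ * ‖spacetimeFourier ψ (ζ - z)‖ₑ) ^ 2 := by
  set r : ℝ := -(2 * Real.pi) with hr
  have hr0 : r ≠ 0 := by rw [hr]; simp [Real.pi_ne_zero]
  set κ : ℝ≥0∞ := ENNReal.ofReal |(r ^ 2)⁻¹| with hκ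
  -- Each rescaling by `-2π` in the plane costs `κ`: one inside the convolution, squared by the L²
  -- norm, and one in the outer integral.
  refine ⟨κ ^ 2 * κ, by finiteness, fun φ ψ => ?_⟩
  have hA := (measurable_spacetimeFourier φ).enorm
  have hB := (measurable_spacetimeFourier ψ).enorm
  set Φ := toEuclidean φ
  set Ψ := toEuclidean ψ
  set H := SchwartzMap.convolution (ContinuousLinearMap.mul ℂ ℂ) (𝓕⁻ Φ) (𝓕⁻ Ψ) with hH
  -- `H` is the convolution of the inverse transforms, so its Fourier transform is the product
  -- itself.
  have hFH : ∀ v, 𝓕 H v = φ v.ofLp * ψ v.ofLp := fun v => by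
    rw [hH, SchwartzMap.fourier_convolution, FourierTransform.fourier_fourierInv_eq,
      FourierTransform.fourier_fourierInv_eq, SchwartzMap.pairing_apply_apply]
    rfl
  have hHv : ∀ v, ‖H v‖ₑ ≤ κ * ∫⁻ z, ‖spacetimeFourier φ z‖ₑ *
      ‖spacetimeFourier ψ (r • v.ofLp - z)‖ₑ := fun v => by
    have hAB : Measurable fun z => ‖spacetimeFourier φ z‖ₑ *
        ‖spacetimeFourier ψ (r • v.ofLp - z)‖ₑ :=
      hA.mul (hB.comp (measurable_const.sub measurable_id))
    rw [hH, SchwartzMap.convolution_apply, convolution_def, hκ, ← lintegral_comp_smul_ofLp hr0 hAB]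
    refine (enorm_integral_le_lintegral_enorm _).trans (le_of_eq ?_)
    refine lintegral_congr fun t => ?_
    rw [ContinuousLinearMap.mul_apply', enorm_mul, fourierInv_toEuclidean,
      fourierInv_toEuclidean, WithLp.ofLp_sub, smul_sub]
  have hm : Measurable fun ζ : ℝ × ℝ =>
      (∫⁻ z, ‖spacetimeFourier φ z‖ₑ * ‖spacetimeFourier ψ (ζ - z)‖ₑ) ^ 2 := by
    refine Measurable.pow_const (Measurable.lintegral_prod_right' (f := fun q : (ℝ × ℝ) × ℝ × ℝ =>
      ‖spacetimeFourier φ q.2‖ₑ * ‖spacetimeFourier ψ (q.1 - q.2)‖ₑ) ?_) 2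
    exact (hA.comp measurable_snd).mul (hB.comp (measurable_fst.sub measurable_snd))
  calc ∫⁻ z : ℝ × ℝ, ‖φ z * ψ z‖ₑ ^ 2
      = ∫⁻ v : WithLp 2 (ℝ × ℝ), ‖φ v.ofLp * ψ v.ofLp‖ₑ ^ 2 :=
        ((WithLp.volume_preserving_ofLp ℝ ℝ).lintegral_comp
          ((φ.continuous.mul ψ.continuous).enorm.measurable.pow_const 2)).symm
    _ = ∫⁻ v, ‖H v‖ₑ ^ 2 := by
        rw [← lintegral_enorm_sq_fourier H]
        simp only [hFH]
    _ ≤ ∫⁻ v : WithLp 2 (ℝ × ℝ), κ ^ 2 * (∫⁻ z, ‖spacetimeFourier φ z‖ₑ *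
          ‖spacetimeFourier ψ (r • v.ofLp - z)‖ₑ) ^ 2 := by
        refine lintegral_mono fun v => ?_
        rw [← mul_pow]
        exact pow_le_pow_left' (hHv v) 2
    _ = _ := by
        rw [lintegral_const_mul' _ _ (by finiteness), lintegral_comp_smul_ofLp hr0 hm, mul_assoc]

/-! ### Integration of the two kernels -/

lemma measurable_bump : Measurable fun q : ℝ × ℝ => bump q.1 q.2 := by
  unfold bump jb
  fun_prop

lemma lintegral_bump_le (l : ℝ) {a : ℝ} (ha : 1 ≤ |a|) (b : ℝ) :
    ∫⁻ x, ENNReal.ofReal (bump l (a * x + b)) ≤ ∫⁻ y, decay (3 / 2) y :=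
  lintegral_scaled_decay_le (Real.rpow_pos_of_pos (jb_pos l) _) ha b

/-- At each fixed frequency the modulation is a reflected translate of the time frequency, so its
integral is the same for all frequencies. -/
lemma lintegral_decay_modulation (r α β : ℝ) {F : ℝ → ℝ≥0∞} (hF : Measurable F) (ζ : ℝ × ℝ) :
    ∫⁻ z : ℝ × ℝ, F z.1 * decay r ((ζ - z).2 - phase α β (ζ - z).1) =
      (∫⁻ x, F x) * ∫⁻ y, decay r y := by
  refine lintegral_mul_comp_modulation hF (measurable_decay r)
    (σ := fun z => (ζ - z).2 - phase α β (ζ - z).1) (by unfold phase; fun_prop) fun x => ?_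
  have := lintegral_sub_left_eq_self (μ := volume) (decay r) (ζ.2 - phase α β (ζ.1 - x))
  rw [← this]
  refine lintegral_congr fun t => ?_
  congr 1
  simp only [Prod.fst_sub, Prod.snd_sub]
  ring

lemma lintegral_decay_modulation' (r α β : ℝ) {F : ℝ → ℝ≥0∞} (hF : Measurable F) (z : ℝ × ℝ) :
    ∫⁻ ζ : ℝ × ℝ, F ζ.1 * decay r ((ζ - z).2 - phase α β (ζ - z).1) =
      (∫⁻ x, F x) * ∫⁻ y, decay r y := by
  refine lintegral_mul_comp_modulation hF (measurable_decay r)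
    (σ := fun ζ => (ζ - z).2 - phase α β (ζ - z).1) (by unfold phase; fun_prop) fun x => ?_
  have := lintegral_sub_right_eq_self (μ := volume) (decay r) (z.2 + phase α β (x - z.1))
  rw [← this]
  refine lintegral_congr fun t => ?_
  congr 1
  simp only [Prod.fst_sub, Prod.snd_sub]
  ring

/-- The part of the squared multiplier that is integrated in the input variable. -/
noncomputable def inputKernel (α β R r : ℝ) (ζ z : ℝ × ℝ) : ℝ≥0∞ :=
  ((if z.1 ^ 2 + (ζ - z).1 ^ 2 ≤ R then 1 else 0) +
    ENNReal.ofReal (bump ζ.1 (2 * z.1 + -ζ.1))) * decay r ((ζ - z).2 - phase α β (ζ - z).1) +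
  highGap α β R z.1 (ζ - z).1 *
    (decay r (z.2 - phase α β z.1) * decay r ((ζ - z).2 - phase α β (ζ - z).1))

/-- The part of the squared multiplier that is integrated in the output variable. -/
noncomputable def outputKernel (α β r : ℝ) (ζ z : ℝ × ℝ) : ℝ≥0∞ :=
  (ENNReal.ofReal (bump z.1 (1 * ζ.1 + 0)) + decay 2 (ζ.1 - z.1)) *
    decay r ((ζ - z).2 - phase α β (ζ - z).1)

lemma measurable_inputKernel (α β R r : ℝ) :
    Measurable (Function.uncurry (inputKernel α β R r)) := by
  have hd := measurable_decay r
  have hp : Measurable (phase α β) := by unfold phase; fun_prop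
  have hb := measurable_bump
  have hg := measurable_highGap α β R
  have h1 : MeasurableSet {q : (ℝ × ℝ) × ℝ × ℝ | q.2.1 ^ 2 + (q.1 - q.2).1 ^ 2 ≤ R} :=
    measurableSet_le (by fun_prop) (by fun_prop)
  have h2 : Measurable fun q : (ℝ × ℝ) × ℝ × ℝ =>
      if q.2.1 ^ 2 + (q.1 - q.2).1 ^ 2 ≤ R then (1 : ℝ≥0∞) else 0 :=
    Measurable.ite h1 measurable_const measurable_const
  have h3 : Measurable fun q : (ℝ × ℝ) × ℝ × ℝ => bump q.1.1 (2 * q.2.1 + -q.1.1) :=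
    hb.comp (f := fun q : (ℝ × ℝ) × ℝ × ℝ => (q.1.1, 2 * q.2.1 + -q.1.1)) (by fun_prop)
  have h4 : Measurable fun q : (ℝ × ℝ) × ℝ × ℝ => highGap α β R q.2.1 (q.1 - q.2).1 :=
    hg.comp (f := fun q : (ℝ × ℝ) × ℝ × ℝ => (q.2.1, (q.1 - q.2).1)) (by fun_prop)
  unfold inputKernel Function.uncurry
  fun_prop

lemma measurable_outputKernel (α β r : ℝ) :
    Measurable (Function.uncurry (outputKernel α β r)) := by
  have hd := measurable_decay r
  have hd2 := measurable_decay 2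
  have hp : Measurable (phase α β) := by unfold phase; fun_prop
  have h3 : Measurable fun q : (ℝ × ℝ) × ℝ × ℝ => bump q.2.1 (1 * q.1.1 + 0) :=
    measurable_bump.comp (f := fun q : (ℝ × ℝ) × ℝ × ℝ => (q.2.1, 1 * q.1.1 + 0)) (by fun_prop)
  unfold outputKernel Function.uncurry
  fun_prop

/-- At fixed output, low frequencies lie in an interval of length `2R`, the bump has scale-free
mass, and the gap term is integrated by the substitution. -/
lemma lintegral_inputKernel_le {α β R : ℝ} (hβ : β ≠ 0) (hR : 3 * |α| ≤ 4 * |β| * R)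
    (hR2 : 2 ≤ R) (r : ℝ) (ζ : ℝ × ℝ) :
    ∫⁻ z, inputKernel α β R r ζ z ≤
      (ENNReal.ofReal (2 * R) + ∫⁻ y, decay (3 / 2) y) * (∫⁻ y, decay r y) +
        2 * (∫⁻ y, decay r y) ^ 2 := by
  have hlow : MeasurableSet {x : ℝ | x ^ 2 + (ζ.1 - x) ^ 2 ≤ R} :=
    measurableSet_le (by fun_prop) (by fun_prop)
  have hind : Measurable fun x : ℝ => if x ^ 2 + (ζ.1 - x) ^ 2 ≤ R then (1 : ℝ≥0∞) else 0 :=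
    Measurable.ite hlow measurable_const measurable_const
  have hbump : Measurable fun x : ℝ => ENNReal.ofReal (bump ζ.1 (2 * x + -ζ.1)) :=
    (measurable_bump.comp (f := fun x : ℝ => (ζ.1, 2 * x + -ζ.1)) (by fun_prop)).ennreal_ofReal
  have hd := measurable_decay r
  have hp : Measurable (phase α β) := by unfold phase; fun_prop
  have hfirst : Measurable fun z : ℝ × ℝ =>
      ((if z.1 ^ 2 + (ζ - z).1 ^ 2 ≤ R then (1 : ℝ≥0∞) else 0) +
        ENNReal.ofReal (bump ζ.1 (2 * z.1 + -ζ.1))) *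
          decay r ((ζ - z).2 - phase α β (ζ - z).1) :=
    ((hind.add hbump).comp measurable_fst).mul (by fun_prop)
  unfold inputKernel
  rw [lintegral_add_left hfirst]
  refine add_le_add ?_ (lintegral_highGap_le hβ hR hd ζ)
  refine (lintegral_decay_modulation r α β (hind.add hbump) ζ).le.trans ?_
  gcongr
  refine (lintegral_add_left hind _).le.trans (add_le_add ?_ (lintegral_bump_le _ (by norm_num) _))
  calc ∫⁻ x, (if x ^ 2 + (ζ.1 - x) ^ 2 ≤ R then (1 : ℝ≥0∞) else 0)
      ≤ ∫⁻ x, (Set.Icc (-R) R).indicator 1 x := by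
        refine lintegral_mono fun x => ?_
        split_ifs with h
        -- `x² ≤ R ≤ R²`, since `R ≥ 2`.
        · have hx : |x| ≤ R :=
            abs_le_of_sq_le_sq (by nlinarith [sq_nonneg (ζ.1 - x)]) (by linarith)
          rw [Set.indicator_of_mem (Set.mem_Icc.2 (abs_le.1 hx))]
          rfl
        · exact zero_le
    _ = ENNReal.ofReal (2 * R) := by
        rw [lintegral_indicator_one measurableSet_Icc, Real.volume_Icc]
        congr 1; ring

lemma lintegral_outputKernel_le (α β r : ℝ) (z : ℝ × ℝ) :
    ∫⁻ ζ, outputKernel α β r ζ z ≤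
      ((∫⁻ y, decay (3 / 2) y) + ∫⁻ y, decay 2 y) * ∫⁻ y, decay r y := by
  have hbump : Measurable fun x : ℝ => ENNReal.ofReal (bump z.1 (1 * x + 0)) :=
    (measurable_bump.comp (f := fun x : ℝ => (z.1, 1 * x + 0)) (by fun_prop)).ennreal_ofReal
  have hd2 : Measurable fun x : ℝ => decay 2 (x - z.1) :=
    (measurable_decay 2).comp (by fun_prop)
  refine (lintegral_decay_modulation' r α β (hbump.add hd2) z).le.trans ?_
  gcongr
  refine (lintegral_add_left hbump _).le.trans (add_le_add (lintegral_bump_le _ (by norm_num) _) ?_)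
  exact (lintegral_sub_right_eq_self (decay 2) z.1).le

/-! ### The estimate for test functions -/

lemma weight_pos (α β s b : ℝ) (ζ : ℝ × ℝ) : 0 < weight α β s b ζ :=
  mul_pos (Real.rpow_pos_of_pos (jb_pos _) _) (Real.rpow_pos_of_pos (jb_pos _) _)

/-- The square of the multiplier is controlled by the two kernels. -/
lemma inv_weight_sq_le {α β : ℝ} (hβ : β ≠ 0) {R : ℝ} (hR : 3 * |α| ≤ 4 * |β| * R)
    (hR2 : 2 ≤ R) : ∃ C : ℝ, 0 ≤ C ∧ ∀ s : ℝ, -1 / 4 ≤ s → ∀ ε : ℝ, 0 < ε → ε < 1 / 8 →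
      ∀ ζ z : ℝ × ℝ,
        ENNReal.ofReal ((weight α β (-1 / 2) (1 / 2 - ε) z)⁻¹ *
          (weight α β s (1 / 2 + ε) (ζ - z))⁻¹) ^ 2 ≤
        ENNReal.ofReal C * inputKernel α β R (1 + 2 * ε) ζ z +
          ENNReal.ofReal C * outputKernel α β (1 + 2 * ε) ζ z := by
  obtain ⟨C, hC0, hC⟩ := multiplier_le hβ hR hR2
  refine ⟨C, hC0, fun s hs ε hε hε8 ζ z => ?_⟩
  set w := ζ - z with hw
  have h := hC ε hε hε8 z.1 w.1 (jb (z.2 - phase α β z.1)) (one_le_jb _)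
  set σ₁ := jb (z.2 - phase α β z.1) with hσ₁
  set σ₂ := jb (w.2 - phase α β w.1) with hσ₂
  have hp₁ : 0 < σ₁ := jb_pos _
  have hp₂ : 0 < σ₂ := jb_pos _
  have hζ : z.1 + w.1 = ζ.1 := by simp [hw]
  have hη : z.1 - w.1 = 2 * z.1 + -ζ.1 := by rw [← hζ]; ring
  have hsq : ((weight α β (-1 / 2) (1 / 2 - ε) z)⁻¹ * (weight α β s (1 / 2 + ε) w)⁻¹) ^ 2 ≤
      jb z.1 * jb w.1 ^ (1 / 2 : ℝ) * σ₁ ^ (-1 + 2 * ε) * σ₂ ^ (-(1 + 2 * ε)) := by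
    rw [mul_pow, inv_pow, inv_pow, weight_sq, weight_sq, mul_inv, mul_inv,
      ← Real.rpow_neg (jb_pos _).le, ← Real.rpow_neg (jb_pos _).le, ← Real.rpow_neg (jb_pos _).le,
      ← Real.rpow_neg (jb_pos _).le]
    have e1 : jb z.1 ^ (-(2 * (-1 / 2)) : ℝ) = jb z.1 := by norm_num
    -- The only use of `s ≥ -1/4`: every such weight is reduced to the endpoint.
    have e2 : jb w.1 ^ (-(2 * s)) ≤ jb w.1 ^ (1 / 2 : ℝ) :=
      Real.rpow_le_rpow_of_exponent_le (one_le_jb _) (by linarith)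
    rw [e1, show -(2 * (1 / 2 - ε)) = -1 + 2 * ε by ring,
      show -(2 * (1 / 2 + ε)) = -(1 + 2 * ε) by ring]
    have := (jb_pos z.1).le
    calc _ ≤ jb z.1 * σ₁ ^ (-1 + 2 * ε) * (jb w.1 ^ (1 / 2 : ℝ) * σ₂ ^ (-(1 + 2 * ε))) := by
          gcongr
      _ = _ := by ring
  have h' := hsq.trans (mul_le_mul_of_nonneg_right h (by positivity : 0 ≤ σ₂ ^ (-(1 + 2 * ε))))
  have hnn : 0 ≤ (weight α β (-1 / 2) (1 / 2 - ε) z)⁻¹ * (weight α β s (1 / 2 + ε) w)⁻¹ :=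
    mul_nonneg (inv_nonneg.2 (weight_nonneg _ _ _ _ _)) (inv_nonneg.2 (weight_nonneg _ _ _ _ _))
  rw [← ENNReal.ofReal_pow hnn]
  refine (ENNReal.ofReal_le_ofReal h').trans (le_of_eq ?_)
  rw [hζ, hη]
  have b1 := bump_nonneg ζ.1 (2 * z.1 + -ζ.1)
  have b2 := bump_nonneg z.1 ζ.1
  have b3 : 0 ≤ jb w.1 ^ (-2 : ℝ) := Real.rpow_nonneg (jb_pos _).le _
  have b4 : 0 ≤ σ₁ ^ (-(1 + 2 * ε)) := by positivity
  have b5 : 0 ≤ σ₂ ^ (-(1 + 2 * ε)) := by positivity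
  set I : ℝ := if z.1 ^ 2 + w.1 ^ 2 ≤ R then 1 else 0 with hI
  have b6 : 0 ≤ I := by rw [hI]; split_ifs <;> norm_num
  set G : ℝ := if R < z.1 ^ 2 + w.1 ^ 2 ∧ ζ.1 ≠ 0 then |phaseGap α β z.1 w.1| else 0 with hG
  have b7 : 0 ≤ G := by rw [hG]; split_ifs <;> positivity
  have eI : (if z.1 ^ 2 + w.1 ^ 2 ≤ R then (1 : ℝ≥0∞) else 0) = ENNReal.ofReal I := by
    rw [hI]; split_ifs <;> simp
  have eG : highGap α β R z.1 w.1 = ENNReal.ofReal G := by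
    rw [highGap, hG, hζ]; split_ifs <;> simp
  have ew : ζ.1 - z.1 = w.1 := rfl
  unfold inputKernel outputKernel decay
  rw [← hw, eI, eG, ew, one_mul, add_zero, ← hσ₁, ← hσ₂, ← ENNReal.ofReal_add b6 b1,
    ← ENNReal.ofReal_mul b4, ← ENNReal.ofReal_mul b7, ← ENNReal.ofReal_mul (add_nonneg b6 b1),
    ← ENNReal.ofReal_add (by positivity) (by positivity), ← ENNReal.ofReal_add b2 b3,
    ← ENNReal.ofReal_mul (add_nonneg b2 b3), ← ENNReal.ofReal_mul hC0, ← ENNReal.ofReal_mul hC0,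
    ← ENNReal.ofReal_add (by positivity) (by positivity)]
  congr 1
  ring

lemma lintegral_weight_sq (α β s b : ℝ) (f : TestFun) :
    ∫⁻ ζ, (ENNReal.ofReal (weight α β s b ζ) * ‖spacetimeFourier f ζ‖ₑ) ^ 2 =
      ENNReal.ofReal (bourgainNorm α β s b f) ^ 2 := by
  have hmem := memLp_weight_mul α β s b f
  have e : ∀ ζ, ‖(weight α β s b ζ : ℂ) * spacetimeFourier f ζ‖ ^ 2 = jb ζ.1 ^ (2 * s) *
      jb (ζ.2 - phase α β ζ.1) ^ (2 * b) * ‖spacetimeFourier f ζ‖ ^ 2 := fun ζ => by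
    rw [norm_mul, Complex.norm_real, Real.norm_of_nonneg (weight_nonneg _ _ _ _ _), mul_pow,
      weight_sq]
  have hint := (memLp_two_iff_integrable_sq_norm hmem.1).1 hmem
  rw [bourgainNorm, ← ENNReal.ofReal_pow (Real.sqrt_nonneg _), Real.sq_sqrt
    (integral_nonneg fun ζ => by rw [← e]; positivity)]
  simp only [← e]
  rw [ofReal_integral_eq_lintegral_ofReal hint (Filter.Eventually.of_forall fun ζ => by positivity)]
  refine lintegral_congr fun ζ => ?_
  rw [ENNReal.ofReal_pow (norm_nonneg _), norm_mul, Complex.norm_real,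
    Real.norm_of_nonneg (weight_nonneg _ _ _ _ _), ENNReal.ofReal_mul (weight_nonneg _ _ _ _ _),
    ofReal_norm]

/-- The bilinear estimate for test functions. -/
theorem exists_eLpNorm_mul_le {α β : ℝ} (hβ : β ≠ 0) {s : ℝ} (hs : -1 / 4 ≤ s) {ε : ℝ}
    (hε : 0 < ε) (hε8 : ε < 1 / 8) : ∃ C : ℝ, 0 < C ∧ ∀ φ ψ : TestFun,
      eLpNorm (fun z : ℝ × ℝ => φ z * ψ z) 2 volume ≤
        ENNReal.ofReal (C * bourgainNorm α β (-1 / 2) (1 / 2 - ε) φ *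
          bourgainNorm α β s (1 / 2 + ε) ψ) := by
  have hb : 0 < |β| := abs_pos.2 hβ
  -- The first entry forces `N ≥ 1` at high frequency, the second makes the quintic term dominate
  -- the cubic one.
  set R : ℝ := max 2 (3 * |α| / (4 * |β|)) with hRdef
  have hR2 : 2 ≤ R := le_max_left _ _
  have hR : 3 * |α| ≤ 4 * |β| * R := by
    have : 3 * |α| / (4 * |β|) ≤ R := le_max_right _ _
    rw [div_le_iff₀ (by positivity)] at this
    linarith
  obtain ⟨c, hc, hconv⟩ := lintegral_enorm_mul_sq_le
  obtain ⟨C₀, -, hC₀⟩ := inv_weight_sq_le hβ hR hR2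
  have hr : (1 : ℝ) < 1 + 2 * ε := by linarith
  have j1 := (lintegral_decay_lt_top hr).ne
  have j2 := (lintegral_decay_lt_top (r := 3 / 2) (by norm_num)).ne
  have j3 := (lintegral_decay_lt_top (r := 2) (by norm_num)).ne
  set A₁ : ℝ≥0∞ := ENNReal.ofReal C₀ * ((ENNReal.ofReal (2 * R) + ∫⁻ y, decay (3 / 2) y) *
    (∫⁻ y, decay (1 + 2 * ε) y) + 2 * (∫⁻ y, decay (1 + 2 * ε) y) ^ 2) with hA₁
  set A₂ : ℝ≥0∞ := ENNReal.ofReal C₀ * (((∫⁻ y, decay (3 / 2) y) + ∫⁻ y, decay 2 y) *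
    ∫⁻ y, decay (1 + 2 * ε) y) with hA₂
  set K : ℝ≥0∞ := c * (2 * (A₁ + A₂)) with hK
  have hKtop : K ≠ ⊤ := by rw [hK, hA₁, hA₂]; finiteness
  -- The added 1 makes the constant positive even if `K = 0`.
  refine ⟨Real.sqrt K.toReal + 1, by positivity, fun φ ψ => ?_⟩
  set nφ := bourgainNorm α β (-1 / 2) (1 / 2 - ε) φ with hnφ
  set nψ := bourgainNorm α β s (1 / 2 + ε) ψ with hnψ
  have pφ : 0 ≤ nφ := Real.sqrt_nonneg _
  have pψ : 0 ≤ nψ := Real.sqrt_nonneg _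
  have hmeas : ∀ s b : ℝ, ∀ f : TestFun, Measurable fun ζ =>
      ENNReal.ofReal (weight α β s b ζ) * ‖spacetimeFourier f ζ‖ₑ := fun s b f =>
    ((continuous_weight α β s b).measurable.ennreal_ofReal).mul
      (measurable_spacetimeFourier f).enorm
  have hschur := lintegral_bilinear_sq_le
    (k₁ := fun ζ z => ENNReal.ofReal C₀ * inputKernel α β R (1 + 2 * ε) ζ z)
    (k₂ := fun ζ z => ENNReal.ofReal C₀ * outputKernel α β (1 + 2 * ε) ζ z)
    ((measurable_inputKernel α β R (1 + 2 * ε)).const_mul (ENNReal.ofReal C₀))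
    ((measurable_outputKernel α β (1 + 2 * ε)).const_mul (ENNReal.ofReal C₀))
    (hmeas (-1 / 2) (1 / 2 - ε) φ) (hmeas s (1 / 2 + ε) ψ) (hC₀ s hs ε hε hε8)
    (C₁ := A₁) (C₂ := A₂)
    (fun ζ => (lintegral_const_mul' _ _ (by finiteness)).le.trans
      (mul_le_mul_right (lintegral_inputKernel_le hβ hR hR2 _ ζ) _))
    (fun z => (lintegral_const_mul' _ _ (by finiteness)).le.trans
      (mul_le_mul_right (lintegral_outputKernel_le α β _ z) _))
  rw [lintegral_weight_sq, lintegral_weight_sq, ← hnφ, ← hnψ] at hschur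
  have hcancel : ∀ ζ z : ℝ × ℝ, ENNReal.ofReal ((weight α β (-1 / 2) (1 / 2 - ε) z)⁻¹ *
      (weight α β s (1 / 2 + ε) (ζ - z))⁻¹) *
      ((ENNReal.ofReal (weight α β (-1 / 2) (1 / 2 - ε) z) * ‖spacetimeFourier φ z‖ₑ) *
        (ENNReal.ofReal (weight α β s (1 / 2 + ε) (ζ - z)) * ‖spacetimeFourier ψ (ζ - z)‖ₑ)) =
      ‖spacetimeFourier φ z‖ₑ * ‖spacetimeFourier ψ (ζ - z)‖ₑ := fun ζ z => by
    have p1 := weight_pos α β (-1 / 2) (1 / 2 - ε) z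
    have p2 := weight_pos α β s (1 / 2 + ε) (ζ - z)
    rw [mul_mul_mul_comm, ← mul_assoc, ← ENNReal.ofReal_mul p1.le,
      ← ENNReal.ofReal_mul (by positivity), ← mul_inv, inv_mul_cancel₀ (by positivity), ENNReal.ofReal_one, one_mul]
  simp only [hcancel] at hschur
  have hsq : ∫⁻ z : ℝ × ℝ, ‖φ z * ψ z‖ₑ ^ 2 ≤
      ENNReal.ofReal ((Real.sqrt K.toReal + 1) * nφ * nψ) ^ 2 := by
    calc _ ≤ _ := hconv φ ψ
      _ ≤ c * (2 * (A₁ + A₂) * (ENNReal.ofReal nφ ^ 2 * ENNReal.ofReal nψ ^ 2)) := by gcongr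
      _ = K * (ENNReal.ofReal nφ ^ 2 * ENNReal.ofReal nψ ^ 2) := by
          rw [hK, ← mul_assoc]
      _ ≤ ENNReal.ofReal (Real.sqrt K.toReal + 1) ^ 2 *
          (ENNReal.ofReal nφ ^ 2 * ENNReal.ofReal nψ ^ 2) := by
          gcongr
          rw [← ENNReal.ofReal_pow (by positivity), ← ENNReal.ofReal_toReal hKtop]
          refine ENNReal.ofReal_le_ofReal ?_
          rw [ENNReal.toReal_ofReal ENNReal.toReal_nonneg]
          nlinarith [Real.sq_sqrt (ENNReal.toReal_nonneg (a := K)), Real.sqrt_nonneg K.toReal]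
      _ = _ := by
          rw [ENNReal.ofReal_mul (by positivity), ENNReal.ofReal_mul (by positivity)]; ring
  rw [eLpNorm_eq_lintegral_rpow_enorm_toReal (by norm_num) (by norm_num)]
  simp only [ENNReal.toReal_ofNat, ENNReal.rpow_two]
  rw [one_div, ENNReal.rpow_inv_le_iff (by norm_num), ENNReal.rpow_two]
  exact hsq

/-! ### Extension to the Bourgain spaces -/

lemma memLp_mul (φ ψ : TestFun) :
    MemLp (fun z : ℝ × ℝ => φ z * ψ z) 2 (volume : Measure (ℝ × ℝ)) :=
  (φ.continuous.mul ψ.continuous).memLp_of_hasCompactSupport φ.hasCompactSupport.mul_right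

/-- The product of two test functions, as a bilinear map to `L²`. -/
noncomputable def mulLp (α β s b s' b' : ℝ) :
    PreX α β s b →ₗ[ℂ] PreX α β s' b' →ₗ[ℂ] Lp ℂ 2 (volume : Measure (ℝ × ℝ)) :=
  LinearMap.mk₂ ℂ (fun u v => (memLp_mul ((toPre α β s b).symm u) ((toPre α β s' b').symm v)).toLp _)
    (fun u u' v => by
      rw [← MemLp.toLp_add]; congr 1; ext z; simp [add_mul])
    (fun c u v => by
      rw [← MemLp.toLp_const_smul]; congr 1; ext z; simp [mul_assoc])
    (fun u v v' => by
      rw [← MemLp.toLp_add]; congr 1; ext z; simp [mul_add])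
    (fun c u v => by
      rw [← MemLp.toLp_const_smul]; congr 1; ext z; simp [mul_left_comm])

/-- A bounded bilinear map extends to the completions, with the same bound. -/
lemma exists_completion_extension {E F G : Type*} [SeminormedAddCommGroup E] [NormedSpace ℂ E]
    [SeminormedAddCommGroup F] [NormedSpace ℂ F] [NormedAddCommGroup G] [NormedSpace ℂ G]
    [CompleteSpace G] (f : E →ₗ[ℂ] F →ₗ[ℂ] G) {C : ℝ} (hf : ∀ u v, ‖f u v‖ ≤ C * ‖u‖ * ‖v‖) :
    ∃ B : UniformSpace.Completion E →L[ℂ] UniformSpace.Completion F →L[ℂ] G,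
      (∀ (u : E) (v : F), B u v = f u v) ∧ ∀ u v, ‖B u v‖ ≤ C * ‖u‖ * ‖v‖ := by
  let M := f.mkContinuous₂ C hf
  -- The first variable is extended with values in the complete space `F →L[ℂ] G`; flipping exposes
  -- the second variable for the same extension.
  let B₁ : UniformSpace.Completion E →L[ℂ] F →L[ℂ] G :=
    M.extend UniformSpace.Completion.toComplL
  let B : UniformSpace.Completion E →L[ℂ] UniformSpace.Completion F →L[ℂ] G :=
    (B₁.flip.extend (UniformSpace.Completion.toComplL (𝕜 := ℂ) (E := F))).flip
  have hB : ∀ (u : E) (v : F), B u v = f u v := fun u v => by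
    have h1 : B₁ u = M u := ContinuousLinearMap.extend_eq M
      (UniformSpace.Completion.denseRange_coe (α := E))
      (UniformSpace.Completion.isUniformInducing_coe E) u
    have h2 : B₁.flip.extend (UniformSpace.Completion.toComplL (𝕜 := ℂ) (E := F)) v =
        B₁.flip v := ContinuousLinearMap.extend_eq _
      (UniformSpace.Completion.denseRange_coe (α := F))
      (UniformSpace.Completion.isUniformInducing_coe F) v
    rw [ContinuousLinearMap.flip_apply, h2, ContinuousLinearMap.flip_apply, h1]
    rfl
  refine ⟨B, hB, fun u v => ?_⟩
  -- Both sides are continuous, so the inequality passes from the dense images of `E` and `F` with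
  -- the same constant.
  induction u, v using UniformSpace.Completion.induction_on₂ with
  | hp => exact isClosed_le (by fun_prop) (by fun_prop)
  | ih u v =>
    rw [hB, UniformSpace.Completion.norm_coe, UniformSpace.Completion.norm_coe]
    exact hf u v

end Kawahara

theorem lemma5p2 :
    ∃ ε₀ : ℝ, 0 < ε₀ ∧ ∀ α β : ℝ, β ≠ 0 → ∀ s : ℝ, -1 / 4 ≤ s → ∀ ε : ℝ, 0 < ε → ε < ε₀ →
      ∃ C : ℝ, 0 < C ∧
        -- the estimate for test functions
        (∀ φ ψ : Kawahara.TestFun,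
          eLpNorm (fun z : ℝ × ℝ => φ z * ψ z) 2 volume ≤
            ENNReal.ofReal (C * Kawahara.bourgainNorm α β (-1 / 2) (1 / 2 - ε) φ *
              Kawahara.bourgainNorm α β s (1 / 2 + ε) ψ)) ∧
        -- the product of test functions extends to a bounded bilinear map on the Bourgain spaces,
        -- with the same estimate
        ∃ B : Kawahara.X α β (-1 / 2) (1 / 2 - ε) →L[ℂ] Kawahara.X α β s (1 / 2 + ε) →L[ℂ]
            Lp ℂ 2 (volume : Measure (ℝ × ℝ)),
          (∀ φ ψ : Kawahara.TestFun,
            (B (Kawahara.toX α β (-1 / 2) (1 / 2 - ε) φ) (Kawahara.toX α β s (1 / 2 + ε) ψ) :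
              ℝ × ℝ → ℂ) =ᵐ[volume] fun z => φ z * ψ z) ∧
          ∀ (u : Kawahara.X α β (-1 / 2) (1 / 2 - ε)) (v : Kawahara.X α β s (1 / 2 + ε)),
            ‖B u v‖ ≤ C * ‖u‖ * ‖v‖ := by
  refine ⟨1 / 8, by norm_num, fun α β hβ s hs ε hε hε8 => ?_⟩
  obtain ⟨C, hC, hest⟩ := Kawahara.exists_eLpNorm_mul_le hβ hs hε hε8 (α := α)
  obtain ⟨B, hB, hbound⟩ := Kawahara.exists_completion_extension
    (Kawahara.mulLp α β (-1 / 2) (1 / 2 - ε) s (1 / 2 + ε)) (C := C) fun u v => by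
      change ‖(Kawahara.memLp_mul _ _).toLp _‖ ≤ _
      rw [Lp.norm_toLp]
      exact ENNReal.toReal_le_of_le_ofReal (by positivity) (hest _ _)
  refine ⟨C, hC, hest, B, fun φ ψ => ?_, hbound⟩
  have h : B (Kawahara.toX α β (-1 / 2) (1 / 2 - ε) φ) (Kawahara.toX α β s (1 / 2 + ε) ψ) =
    (Kawahara.memLp_mul φ ψ).toLp _ := hB _ _
  rw [h]
  exact (Kawahara.memLp_mul φ ψ).coeFn_toLp
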